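/- Let $\Delta\subset\mathbb{C}$ be the open unit disk, $\mathbb{H}\subset\mathbb{C}$ the upper half-plane, $0\le r\le n$, and let $U=\{t\in\Delta^n : t_1\cdots t_r\neq 0\}$ be the complement of the divisor $t_1\cdots t_r=0$. Let $\mathcal{H}$ be a local system on $U$ with fibre $\mathbb{Z}^d$ and unipotent monodromy. Trivialize its pullback to the universal covering space $\mathbb{H}^r\times\Delta^{n-r}\to U$, $z\mapsto(e^{2\pi i z_1},\dots,e^{2\pi i z_r},z_{r+1},\dots,z_n)$; let $T_j\in \mathrm{GL}_d(\mathbb{Z})$ be the monodromy matrix around $t_j=0$, so that $(z+e_j,h)$ and $(z,T_jh)$ represent the same point of the local system for $j\le r$, while $T_j=\mathrm{id}$ for $j>r$; and put $N_j=-\log T_j=\sum_{m\ge1}\frac1m(\mathrm{id}-T_j)^m$. Use the frame $s_1,\dots,s_d$ of the canonical extension of $\mathcal{H}\otimes\mathcal{O}_U$ to $\Delta^n$ whose pullbacks are $\tilde s_i(z)=e^{z_1N_1+\cdots+z_nN_n}e_i$ (with $e_i$ the standard basis) to identify the total space of this extension with $\Delta^n\times\mathbb{C}^d$. Let $T_U\subseteq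 U\times\mathbb{C}^d$ be the total space of $\mathcal{H}$, embedded in this way: $(t,v)\in T_U$ if and only if $t\in U$ and $\sum_i v_i s_i(t)$ lies in the stalk $\mathcal{H}_t$. For $h\in\mathbb{Z}^d$ let $C(h)\subseteq\Delta^n\times\mathbb{C}^d$ be the image of $$\mathbb{H}^n\to\Delta^n\times\mathbb{C}^d,\qquad z\mapsto\bigl(e^{2\pi i z_1},\dots,e^{2\pi i z_n},\,e^{-(z_1N_1+\cdots+z_nN_n)}h\bigr).$$ All closures are taken inside $\Delta^n\times\mathbb{C}^d$. Then $\overline{T_U}$ is a (reduced) analytic subset of $\Delta^n\times\mathbb{C}^d$. It has countably many irreducible components; these are exactly the sets $\overline{C(h)}$ with $h\in\mathbb{Z}^d$, and $\overline{T_U}=\bigcup_{h\in\mathbb{Z}^d}\overline{C(h)}$. Moreover, only finitely many distinct sets among the $\overline{C(h)}$ pass through any given point of $\Delta^n\times\mathbb{C}^d$. -/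

import Mathlib

open scoped Matrix

noncomputable section

/-! ## Analytic subsets and their irreducible components -/

/-- `X` is an analytic subset of the open set `Ω` of a complex normed space: near every point
of `Ω` (not only of `X`, so `X` is closed in `Ω`) it is the common zero set of finitely many
holomorphic functions. An analytic subset is a reduced analytic space with the sheaf of
restrictions of holomorphic functions; no further structure is involved. -/
def IsAnalyticSubset {E : Type*} [NormedAddCommGroup E] [NormedSpace ℂ E]
    (Ω X : Set E) : Prop :=
  X ⊆ Ω ∧ ∀ p ∈ Ω, ∃ W : Set E, IsOpen W ∧ p ∈ W ∧ W ⊆ Ω ∧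
    ∃ (k : ℕ) (g : Fin k → E → ℂ), (∀ i, DifferentiableOn ℂ (g i) W) ∧
      X ∩ W = {x | x ∈ W ∧ ∀ i, g i x = 0}

/-- A nonempty analytic subset of `Ω` that is not the union of two proper analytic subsets. -/
def IsIrreducibleAnalyticSubset {E : Type*} [NormedAddCommGroup E] [NormedSpace ℂ E]
    (Ω Z : Set E) : Prop :=
  IsAnalyticSubset Ω Z ∧ Z.Nonempty ∧
    ∀ A B : Set E, IsAnalyticSubset Ω A → IsAnalyticSubset Ω B → Z = A ∪ B → Z = A ∨ Z = B

/-- The irreducible components of an analytic subset `X` of `Ω`: the maximal irreducible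
analytic subsets of `Ω` that are contained in `X`. -/
def irreducibleAnalyticComponents {E : Type*} [NormedAddCommGroup E] [NormedSpace ℂ E]
    (Ω X : Set E) : Set (Set E) :=
  {Z | Maximal (fun Y : Set E => IsIrreducibleAnalyticSubset Ω Y ∧ Y ⊆ X) Z}

/-! ## Local systems -/

/-- A local system on `B` of free abelian groups of rank `d`, given by its stalks and by the
topology of its total space (the étale space of the locally constant sheaf): locally on `B` it
is isomorphic, as a space over `B` with a group structure on the fibres, to `B × ℤ^d` with
discrete `ℤ^d`. -/
structure LocalSystem (B : Type*) [TopologicalSpace B] (d : ℕ) where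
  Fiber : B → Type*
  addCommGroup : ∀ b, AddCommGroup (Fiber b)
  topology : TopologicalSpace (Bundle.TotalSpace (Fin d → ℤ) Fiber)
  locally_trivial : ∀ b : B,
    ∃ φ : Bundle.Trivialization (Fin d → ℤ)
        (Bundle.TotalSpace.proj : Bundle.TotalSpace (Fin d → ℤ) Fiber → B),
      b ∈ φ.baseSet ∧ ∀ x ∈ φ.baseSet, ∀ v w : Fiber x,
        (φ ⟨x, v + w⟩).2 = (φ ⟨x, v⟩).2 + (φ ⟨x, w⟩).2

attribute [instance] LocalSystem.addCommGroup LocalSystem.topology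

/-- The total space of a local system. -/
abbrev LocalSystem.Total {B : Type*} [TopologicalSpace B] {d : ℕ} (𝓗 : LocalSystem B d) :
    Type _ :=
  Bundle.TotalSpace (Fin d → ℤ) 𝓗.Fiber

/-! ## The polydisk and the complement of the divisor -/

/-- The open polydisk `Δ^n`. -/
def polydisk (n : ℕ) : Set (Fin n → ℂ) := {t | ∀ j, ‖t j‖ < 1}

/-- The complement `U` in `Δ^n` of the divisor with equation `t_1 ⋯ t_r = 0`. -/
def divisorComplement (n r : ℕ) : Set (Fin n → ℂ) :=
  {t | t ∈ polydisk n ∧ ∀ j : Fin n, (j : ℕ) < r → t j ≠ 0}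

/-- The product `ℍ^r × Δ^(n-r)`, the universal covering space of `U`. -/
def universalCover (n r : ℕ) : Set (Fin n → ℂ) :=
  {z | ∀ j : Fin n, if (j : ℕ) < r then 0 < (z j).im else ‖z j‖ < 1}

/-- The covering map: `e^{2πi z_j}` in the first `r` coordinates, the identity in the others. -/
def coverFun (n r : ℕ) (z : Fin n → ℂ) : Fin n → ℂ :=
  fun j => if (j : ℕ) < r then Complex.exp (2 * Real.pi * Complex.I * z j) else z j

theorem coverFun_mem {n r : ℕ} {z : Fin n → ℂ} (hz : z ∈ universalCover n r) :
    coverFun n r z ∈ divisorComplement n r := by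
  refine ⟨fun j => ?_, fun j hj => ?_⟩
  · have h := hz j
    by_cases hj : (j : ℕ) < r
    · simp only [hj, if_true] at h
      simp only [coverFun, hj, if_true, Complex.norm_exp]
      rw [Real.exp_lt_one_iff]
      have : (2 * Real.pi * Complex.I * z j).re = -(2 * Real.pi * (z j).im) := by
        simp [Complex.mul_re, Complex.mul_im]
      rw [this]
      have := mul_pos Real.two_pi_pos h
      linarith
    · simpa only [coverFun, hj, if_false] using h
  · simp only [coverFun, hj, if_true]
    exact Complex.exp_ne_zero _

/-- The universal covering map `ℍ^r × Δ^(n-r) → U`. -/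
def coverMap (n r : ℕ) (z : universalCover n r) : divisorComplement n r :=
  ⟨coverFun n r z, coverFun_mem z.2⟩

theorem add_single_mem {n r : ℕ} {z : Fin n → ℂ} (hz : z ∈ universalCover n r)
    {j : Fin n} (hj : (j : ℕ) < r) : z + Pi.single j 1 ∈ universalCover n r := by
  intro i
  have h := hz i
  by_cases hij : i = j
  · subst hij
    simpa [hj] using h
  · simpa [Pi.single_eq_of_ne hij] using h

/-- The translation `z ↦ z + e_j` of the universal covering space, for `j ≤ r`. -/
def deckShift {n r : ℕ} (j : Fin n) (hj : (j : ℕ) < r) (z : universalCover n r) :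
    universalCover n r :=
  ⟨(z : Fin n → ℂ) + Pi.single j 1, add_single_mem z.2 hj⟩

/-! ## Monodromy and the canonical extension -/

/-- An isomorphism of the pullback of a local system on `U` to the universal covering space
with the constant local system `ℤ^d`. (It always exists; choosing one amounts to choosing a
basis of one stalk.) -/
structure PullbackTrivialization {n r d : ℕ}
    (𝓗 : LocalSystem (divisorComplement n r) d) where
  coord : ∀ z : universalCover n r, 𝓗.Fiber (coverMap n r z) ≃+ (Fin d → ℤ)
  continuous_symm : Continuous fun p : universalCover n r × (Fin d → ℤ) =>
    (⟨coverMap n r p.1, (coord p.1).symm p.2⟩ : 𝓗.Total)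

/-- The point of the total space of the local system that is represented by `(z, h)`. -/
def PullbackTrivialization.point {n r d : ℕ} {𝓗 : LocalSystem (divisorComplement n r) d}
    (τ : PullbackTrivialization 𝓗) (z : universalCover n r) (h : Fin d → ℤ) : 𝓗.Total :=
  ⟨coverMap n r z, (τ.coord z).symm h⟩

/-- `T_j` is the matrix of the monodromy around `t_j = 0`: the points `(z + e_j, h)` and
`(z, T_j h)` of the pullback are the same point of the local system. Around the coordinate
hyperplanes that do not belong to the divisor the local system has no monodromy. -/
def IsMonodromy {n r d : ℕ} {𝓗 : LocalSystem (divisorComplement n r) d}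
    (τ : PullbackTrivialization 𝓗) (T : Fin n → Matrix (Fin d) (Fin d) ℤ) : Prop :=
  (∀ (j : Fin n) (hj : (j : ℕ) < r) (z : universalCover n r) (h : Fin d → ℤ),
    τ.point (deckShift j hj z) h = τ.point z (T j *ᵥ h)) ∧
  ∀ j : Fin n, r ≤ (j : ℕ) → T j = 1

/-- `N = -log T = ∑_{m ≥ 1} (1/m) (1 - T)^m` for a unipotent `d × d` matrix `T`; the terms
with `m > d` (indeed `m ≥ d`) vanish. -/
def negLog {d : ℕ} (T : Matrix (Fin d) (Fin d) ℤ) : Matrix (Fin d) (Fin d) ℂ :=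
  ∑ m ∈ Finset.Icc 1 d, (1 / (m : ℂ)) • (1 - T.map (Int.cast : ℤ → ℂ)) ^ m

/-- The pullback `e^{z_1 N_1 + ⋯ + z_n N_n} e_i` to the universal covering space of the `i`-th
section of the distinguished frame of the canonical extension. -/
def frameSection {n d : ℕ} (N : Fin n → Matrix (Fin d) (Fin d) ℂ) (z : Fin n → ℂ)
    (i : Fin d) : Fin d → ℂ :=
  NormedSpace.exp (∑ j, z j • N j) *ᵥ Pi.single i 1

/-- The total space `T_U` of the local system, inside the total space `Δ^n × ℂ^d` of the
canonical extension: the pairs `(t, v)` such that `∑ v_i s_i(t)` is an element `x` of the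
stalk of the local system at `t ∈ U`. -/
def totalSpaceInExtension {n r d : ℕ} {𝓗 : LocalSystem (divisorComplement n r) d}
    (τ : PullbackTrivialization 𝓗) (T : Fin n → Matrix (Fin d) (Fin d) ℤ) :
    Set ((Fin n → ℂ) × (Fin d → ℂ)) :=
  {p | ∃ (z : universalCover n r) (x : 𝓗.Fiber (coverMap n r z)),
    p.1 = coverFun n r z ∧
    ∑ i, p.2 i • frameSection (fun j => negLog (T j)) z i = fun k => (τ.coord z x k : ℂ)}

/-- The sheet `C(h)`: the image of `ℍ^n` under
`z ↦ (e^{2πi z_1}, …, e^{2πi z_n}, e^{-(z_1 N_1 + ⋯ + z_n N_n)} h)`. -/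
def sheet {n d : ℕ} (T : Fin n → Matrix (Fin d) (Fin d) ℤ) (h : Fin d → ℤ) :
    Set ((Fin n → ℂ) × (Fin d → ℂ)) :=
  {p | ∃ z : Fin n → ℂ, (∀ j, 0 < (z j).im) ∧
    p = (fun j => Complex.exp (2 * Real.pi * Complex.I * z j),
      NormedSpace.exp (-∑ j, z j • negLog (T j)) *ᵥ fun k => (h k : ℂ))}

/-- The closure of `S` inside `Δ^n × ℂ^d`. -/
def closureInExtension {n d : ℕ} (S : Set ((Fin n → ℂ) × (Fin d → ℂ))) :
    Set ((Fin n → ℂ) × (Fin d → ℂ)) :=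
  closure S ∩ polydisk n ×ˢ Set.univ

end

/-!
Write `zN = ∑ z_j N_j`. After the choice of the trivialization, `T_U` consists of the points
`(t(z), e^{-zN} h)` with `h ∈ ℤ^d`; the sheets `C(h)` are the images of convex open sets under
holomorphic maps. The proof describes each closure by explicit equations and shows that
the family of the closures is locally finite.

*Equations.* The `N_j` commute and are nilpotent, so that `v = e^{-zN} h` runs through an orbit of
a unipotent group. Its parameter `z` is an entire function `σ(v)` of the point, up to the Lie
algebra `V = {w | (wN) h = 0}` of the stabilizer (`exists_orbit_section`). Therefore the orbit is
given by `e^{σ(v)N} v = h`, and the automorphism `(t, v) ↦ (t e^{-2πi σ(v)}, v)` carries `C(h)`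
into the product of the subtorus `exp (2πi V)` with the orbit. As `V` is defined over `ℚ`, the
closure of this subtorus in `ℂ^n` is the toric variety cut out by the binomials of its integral
relations: a point of the variety agrees with a point of the subtorus in its nonzero coordinates
(`exists_mem_complexKer_torusExp_apply_eq`), and by Farkas' lemma the remaining coordinates are
contracted by a one-parameter subgroup (`exists_mem_complexKer_pos`). Hilbert's basis theorem
reduces the binomials to finitely many, so the closure of `C(h)` is analytic
(`closureInExtension_sheet`, `isAnalyticSubset_closureInExtension_sheet`).

*Local finiteness.* Only finitely many `h ∈ ℤ^d` have `‖e^{-zN} h‖ ≤ R` for some `z` with bounded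
real part (`finite_setOf_norm_unip_mulVec_le`). By induction on the order of nilpotency the
integral vectors `d! N_j h` take finitely many values. For given values, the section `σ` shows that
`im z` is a bounded distance from some real `w` with `(wN) N_j h = 0` for all `j`; then
`e^{-i wN} h = h - i (wN) h` is bounded, and `h` is its real part. Integral translations of `z`
replace `h` by another vector with the same sheet, so only finitely many closures of sheets
meet a bounded region.

*Components.* A dense holomorphic image of a convex open set makes an analytic set irreducible, by
the identity theorem. Over the locus where no coordinate of `t` vanishes, `C(h)` is closed, so an
inclusion between two closures forces the vectors to be in the same monodromy orbit. The
components of a locally finite union of irreducible analytic sets without inclusions are its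
members (`irreducibleAnalyticComponents_sUnion`).
-/

noncomputable section

/-! ### Exponentials of commuting nilpotent matrices -/

/-- Every linear map between vector spaces has a generalized inverse. -/
theorem LinearMap.exists_comp_comp_self {K E F : Type*} [Field K] [AddCommGroup E] [Module K E]
    [AddCommGroup F] [Module K F] (f : E →ₗ[K] F) :
    ∃ g : F →ₗ[K] E, ∀ x, f (g (f x)) = f x := by
  obtain ⟨g, hg⟩ := f.rangeRestrict.exists_rightInverse_of_surjective f.range_rangeRestrict
  obtain ⟨g', hg'⟩ := g.exists_extend
  refine ⟨g', fun x => ?_⟩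
  have h1 : g' (f x) = g (f.rangeRestrict x) := by
    rw [← hg']; rfl
  have h2 : f.rangeRestrict (g (f.rangeRestrict x)) = f.rangeRestrict x :=
    LinearMap.congr_fun hg (f.rangeRestrict x)
  rw [h1]
  exact congrArg Subtype.val h2

theorem Matrix.differentiable_mulVec {E : Type*} [NormedAddCommGroup E] [NormedSpace ℂ E] {d : ℕ}
    {M : E → Matrix (Fin d) (Fin d) ℂ} {v : E → Fin d → ℂ}
    (hM : ∀ i j, Differentiable ℂ fun x => M x i j) (hv : Differentiable ℂ v) :
    Differentiable ℂ fun x => M x *ᵥ v x := by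
  rw [differentiable_pi] at hv ⊢
  intro i
  simp only [Matrix.mulVec, dotProduct]
  exact Differentiable.fun_sum fun j _ => (hM i j).mul (hv j)

section Norms
open scoped Matrix.Norms.Operator

theorem Matrix.differentiable_exp_apply {d : ℕ} (i j : Fin d) :
    Differentiable ℂ fun M : Matrix (Fin d) (Fin d) ℂ => NormedSpace.exp M i j := by
  have h : Differentiable ℂ (NormedSpace.exp : Matrix (Fin d) (Fin d) ℂ → _) := fun M =>
    (NormedSpace.exp_analytic (𝕂 := ℂ) M).differentiableAt
  have h2 : Differentiable ℂ fun M : Matrix (Fin d) (Fin d) ℂ => M i j :=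
    ((Matrix.entryLinearMap ℂ ℂ i j).toContinuousLinearMap).differentiable
  exact h2.comp h

end Norms

section NormedAlgebra

variable {𝔸 : Type*} [NormedRing 𝔸] [NormedAlgebra ℂ 𝔸] [CompleteSpace 𝔸]

theorem hasDerivAt_exp_of_commute {g : ℂ → 𝔸} {g' : 𝔸} {s : ℂ} (hg : HasDerivAt g g' s)
    (hc : ∀ a b, Commute (g a) (g b)) :
    HasDerivAt (fun a => NormedSpace.exp (g a)) (NormedSpace.exp (g s) * g') s := by
  let _ : NormedAlgebra ℚ 𝔸 := .restrictScalars ℚ ℂ 𝔸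
  have h1 : HasDerivAt (fun a => g a - g s) g' s := hg.sub_const _
  have h2 : HasFDerivAt (NormedSpace.exp : 𝔸 → 𝔸) (1 : 𝔸 →L[ℂ] 𝔸) (g s - g s) := by
    rw [sub_self]; exact hasFDerivAt_exp_zero
  have h3 := (h2.comp_hasDerivAt s h1).const_mul (NormedSpace.exp (g s))
  have h4 : (fun a => NormedSpace.exp (g a)) =
      fun a => NormedSpace.exp (g s) * (NormedSpace.exp ∘ fun a => g a - g s) a := by
    funext a
    rw [Function.comp, ← NormedSpace.exp_add_of_commute ((hc s a).sub_right (hc s s))]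
    congr 1; abel
  rw [h4]
  exact h3

/-- The exponential of `∑_{m = 1}^d u^m / m = - log (1 - u)` is the inverse of `1 - u`. The
function `s ↦ exp (∑ s^m u^m / m) (1 - s u)` has derivative zero. -/
theorem exp_sum_pow_div_mul_one_sub {d : ℕ} {u : 𝔸} (hu : u ^ d = 0) :
    NormedSpace.exp (∑ m ∈ Finset.Icc 1 d, (1 / (m : ℂ)) • u ^ m) * (1 - u) = 1 := by
  set g : ℂ → 𝔸 :=
    fun s => ∑ m ∈ Finset.Icc 1 d, s ^ m • (1 / (m : ℂ)) • u ^ m with hg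
  have hd : ∀ s, HasDerivAt g (∑ m ∈ Finset.Icc 1 d, s ^ (m - 1) • u ^ m) s := by
    intro s
    refine HasDerivAt.fun_sum fun m hm => ?_
    have hm0 : (m : ℂ) ≠ 0 := by
      have := (Finset.mem_Icc.mp hm).1
      exact_mod_cast (by omega : m ≠ 0)
    have := (hasDerivAt_pow m s).smul_const ((1 / (m : ℂ)) • u ^ m)
    convert this using 1
    rw [smul_smul]
    congr 1
    field_simp
  have hc : ∀ a b, Commute (g a) (g b) := by
    intro a b
    refine Commute.sum_left _ _ _ fun i _ => Commute.sum_right _ _ _ fun j _ => ?_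
    exact (((Commute.refl u).pow_pow i j).smul_left _ |>.smul_left _).smul_right _ |>.smul_right _
  have htel : ∀ s : ℂ, (∑ m ∈ Finset.Icc 1 d, s ^ (m - 1) • u ^ m) * (1 - s • u) = u := by
    intro s
    have hgen : ∀ k : ℕ, (∑ m ∈ Finset.Icc 1 k, s ^ (m - 1) • u ^ m) * (1 - s • u)
        = u - s ^ k • u ^ (k + 1) := by
      intro k
      induction k with
      | zero => simp
      | succ k ih =>
        rw [Finset.sum_Icc_succ_top (by omega), add_mul, ih]
        simp only [add_tsub_cancel_right, mul_sub, mul_one, smul_mul_smul_comm, ← pow_succ]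
        abel
    rw [hgen d, pow_succ, hu]; simp
  have hconst : ∀ s, HasDerivAt (fun a : ℂ => NormedSpace.exp (g a) * (1 - a • u)) 0 s := by
    intro s
    have h1 := hasDerivAt_exp_of_commute (hd s) hc
    have h2 : HasDerivAt (fun a : ℂ => 1 - a • u) (-u) s := by
      simpa using ((hasDerivAt_id s).smul_const u).const_sub 1
    have h3 := h1.mul h2
    rw [mul_assoc, htel, mul_neg, add_neg_cancel] at h3
    exact h3
  have h01 := is_const_of_deriv_eq_zero (fun s => (hconst s).differentiableAt)
    (fun s => (hconst s).deriv) 1 0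
  have h0 : g 0 = 0 := by
    refine Finset.sum_eq_zero fun m hm => ?_
    have := (Finset.mem_Icc.mp hm).1
    rw [zero_pow (by omega), zero_smul]
  have h1 : g 1 = ∑ m ∈ Finset.Icc 1 d, (1 / (m : ℂ)) • u ^ m := by
    simp [hg]
  simpa [h0, h1] using h01

end NormedAlgebra

theorem Matrix.pow_eq_zero_of_isNilpotent {d : ℕ} {u : Matrix (Fin d) (Fin d) ℂ}
    (hu : IsNilpotent u) : u ^ d = 0 := by
  have h := Matrix.isNilpotent_charpoly_sub_pow_of_isNilpotent hu
  have h2 : u.charpoly = Polynomial.X ^ d := by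
    simpa [sub_eq_zero] using h.eq_zero
  have h3 := Matrix.aeval_self_charpoly u
  rwa [h2, map_pow, Polynomial.aeval_X] at h3

theorem isNilpotent_map_intCast {d : ℕ} {T : Matrix (Fin d) (Fin d) ℤ}
    (hT : IsNilpotent (T - 1)) :
    IsNilpotent (1 - T.map (Int.cast : ℤ → ℂ)) := by
  have h := (hT.map (Int.castRingHom ℂ).mapMatrix).neg
  simpa [map_sub] using h

/-- The matrix `negLog T = -log T` of a unipotent `T` satisfies `exp (-(-log T)) = T`. -/
theorem exp_neg_negLog {d : ℕ} {T : Matrix (Fin d) (Fin d) ℤ} (hT : IsNilpotent (T - 1)) :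
    NormedSpace.exp (-negLog T) = T.map (Int.cast : ℤ → ℂ) := by
  have h := open scoped Matrix.Norms.Operator in exp_sum_pow_div_mul_one_sub
    (Matrix.pow_eq_zero_of_isNilpotent (isNilpotent_map_intCast hT))
  rw [sub_sub_cancel] at h
  rw [Matrix.exp_neg]
  exact Matrix.inv_eq_right_inv h

theorem isNilpotent_negLog {d : ℕ} {T : Matrix (Fin d) (Fin d) ℤ} (hT : IsNilpotent (T - 1)) :
    IsNilpotent (negLog T) := by
  have hu := isNilpotent_map_intCast hT
  refine Commute.isNilpotent_sum (fun m hm => ?_) (fun i j _ _ => ?_)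
  · exact (hu.pow_of_pos (by have := (Finset.mem_Icc.mp hm).1; omega)).smul _
  · exact (((Commute.refl _).pow_pow i j).smul_left _).smul_right _

theorem commute_negLog {d : ℕ} {S T : Matrix (Fin d) (Fin d) ℤ} (h : Commute S T) :
    Commute (negLog S) (negLog T) := by
  have h0 : Commute (S.map (Int.cast : ℤ → ℂ)) (T.map (Int.cast : ℤ → ℂ)) :=
    h.map (Int.castRingHom ℂ).mapMatrix
  have h1 : Commute (1 - S.map (Int.cast : ℤ → ℂ)) (1 - T.map (Int.cast : ℤ → ℂ)) :=
    Commute.sub_left (Commute.one_left _) (Commute.sub_right (Commute.one_right _) h0)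
  refine Commute.sum_left _ _ _ fun i _ => Commute.sum_right _ _ _ fun j _ => ?_
  exact ((h1.pow_pow i j).smul_left _).smul_right _

theorem negLog_one {d : ℕ} : negLog (1 : Matrix (Fin d) (Fin d) ℤ) = 0 := by
  refine Finset.sum_eq_zero fun m hm => ?_
  have := (Finset.mem_Icc.mp hm).1
  have h1 : (1 : Matrix (Fin d) (Fin d) ℤ).map (Int.cast : ℤ → ℂ) = 1 :=
    (Int.castRingHom ℂ).mapMatrix.map_one
  rw [h1, sub_self, zero_pow (by omega), smul_zero]

/-- The denominators of `negLog T` divide `d!`. -/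
theorem exists_factorial_smul_negLog {d : ℕ} (T : Matrix (Fin d) (Fin d) ℤ) :
    ∃ M : Matrix (Fin d) (Fin d) ℤ,
      (d.factorial : ℂ) • negLog T = M.map (Int.cast : ℤ → ℂ) := by
  refine ⟨∑ m ∈ Finset.Icc 1 d, ((d.factorial / m : ℕ) : ℤ) • (1 - T) ^ m, ?_⟩
  have : ∀ M : Matrix (Fin d) (Fin d) ℤ, M.map (Int.cast : ℤ → ℂ) =
      (Int.castRingHom ℂ).mapMatrix M := fun _ => rfl
  rw [this, map_sum, negLog, Finset.smul_sum]
  refine Finset.sum_congr rfl fun m hm => ?_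
  obtain ⟨h1, h2⟩ := Finset.mem_Icc.mp hm
  have hm0 : (m : ℂ) ≠ 0 := by exact_mod_cast (by omega : m ≠ 0)
  rw [map_zsmul, map_pow, map_sub, map_one, ← this, smul_smul, ← Int.cast_smul_eq_zsmul ℂ]
  congr 1
  rw [Int.cast_natCast, Nat.cast_div (Nat.dvd_factorial h1 h2) hm0]
  ring

/-! ### Orbits of the unipotent group generated by commuting matrices -/

/-- If `M² v = 0`, the exponential series of `M` applied to `v` stops after the linear term. -/
theorem Matrix.exp_mulVec_of_mulVec_mulVec_eq_zero {d : ℕ} {M : Matrix (Fin d) (Fin d) ℂ}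
    {v : Fin d → ℂ} (h : M *ᵥ (M *ᵥ v) = 0) : NormedSpace.exp M *ᵥ v = v + M *ᵥ v := by
  have h1 : HasSum (fun k : ℕ => ((k.factorial : ℂ)⁻¹) • M ^ k) (NormedSpace.exp M) := by
    open scoped Matrix.Norms.Operator in exact NormedSpace.exp_series_hasSum_exp' (𝕂 := ℂ) M
  have h2 := h1.map (Matrix.mulVec.addMonoidHomLeft v)
    (show Continuous fun M : Matrix (Fin d) (Fin d) ℂ => M *ᵥ v from
      continuous_id.matrix_mulVec continuous_const)
  have h3 : ∀ k ∉ Finset.range 2, (Matrix.mulVec.addMonoidHomLeft v ∘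
      fun k : ℕ => ((k.factorial : ℂ)⁻¹) • M ^ k) k = 0 := by
    intro k hk
    obtain ⟨m, rfl⟩ : ∃ m, k = m + 2 := ⟨k - 2, by simp at hk; omega⟩
    simp only [Function.comp, Matrix.mulVec.addMonoidHomLeft, AddMonoidHom.coe_mk, ZeroHom.coe_mk]
    rw [Matrix.smul_mulVec, pow_add, pow_two, ← Matrix.mulVec_mulVec, ← Matrix.mulVec_mulVec, h,
      Matrix.mulVec_zero, smul_zero]
  have h4 := h2.unique (hasSum_sum_of_ne_finset_zero h3)
  simpa [Finset.sum_range_succ, Matrix.mulVec.addMonoidHomLeft] using h4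

section Orbit

variable {n d : ℕ} (N : Fin n → Matrix (Fin d) (Fin d) ℂ)

/-- The linear combination `z_1 N_1 + ⋯ + z_n N_n`, applied to `v`, as a linear map in `z`. -/
def pencilAt (v : Fin d → ℂ) : (Fin n → ℂ) →ₗ[ℂ] (Fin d → ℂ) where
  toFun z := (∑ j, z j • N j) *ᵥ v
  map_add' z w := by simp [add_smul, Finset.sum_add_distrib, Matrix.add_mulVec]
  map_smul' a z := by
    simp [mul_smul, ← Finset.smul_sum, Matrix.smul_mulVec]

/-- The unipotent matrix `e^{-(z_1 N_1 + ⋯ + z_n N_n)}`. -/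
def unip (z : Fin n → ℂ) : Matrix (Fin d) (Fin d) ℂ := NormedSpace.exp (-∑ j, z j • N j)

theorem pencilAt_apply (v : Fin d → ℂ) (z : Fin n → ℂ) :
    pencilAt N v z = ∑ j, z j • (N j *ᵥ v) := by
  simp [pencilAt, Matrix.sum_mulVec, Matrix.smul_mulVec]

theorem differentiable_unip_mulVec {E : Type*} [NormedAddCommGroup E] [NormedSpace ℂ E]
    {a : E → Fin n → ℂ} {v : E → Fin d → ℂ} (ha : Differentiable ℂ a) (hv : Differentiable ℂ v) :
    Differentiable ℂ fun x => unip N (a x) *ᵥ v x := by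
  refine Matrix.differentiable_mulVec (fun i j => ?_) hv
  rw [differentiable_pi] at ha
  open scoped Matrix.Norms.Operator in
  have h1 : Differentiable ℂ fun x => -∑ j, a x j • N j :=
    (Differentiable.fun_sum fun j _ => (ha j).smul_const (N j)).neg
  exact (Matrix.differentiable_exp_apply i j).comp h1

variable {N}

theorem unip_zero : unip N 0 = 1 := by
  simp [unip, NormedSpace.exp_zero]

theorem unip_add (hN : ∀ i j, Commute (N i) (N j)) (z w : Fin n → ℂ) :
    unip N (z + w) = unip N z * unip N w := by
  unfold unip
  rw [← Matrix.exp_add_of_commute]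
  · simp only [Pi.add_apply, add_smul, Finset.sum_add_distrib]; congr 1; abel
  · refine (Commute.neg_left (Commute.neg_right ?_))
    exact Commute.sum_left _ _ _ fun i _ => Commute.sum_right _ _ _ fun j _ =>
      ((hN i j).smul_left _).smul_right _

theorem unip_neg_mulVec_unip_mulVec (hN : ∀ i j, Commute (N i) (N j)) (z : Fin n → ℂ)
    (v : Fin d → ℂ) : unip N (-z) *ᵥ (unip N z *ᵥ v) = v := by
  rw [Matrix.mulVec_mulVec, ← unip_add hN, neg_add_cancel, unip_zero, Matrix.one_mulVec]

theorem mulVec_unip_mulVec (hN : ∀ i j, Commute (N i) (N j)) (j : Fin n) (z : Fin n → ℂ)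
    (v : Fin d → ℂ) : N j *ᵥ (unip N z *ᵥ v) = unip N z *ᵥ (N j *ᵥ v) := by
  rw [Matrix.mulVec_mulVec, Matrix.mulVec_mulVec]
  congr 1
  exact (Commute.exp_right (Commute.neg_right (Commute.sum_right _ _ _ fun i _ =>
    (hN j i).smul_right _))).eq

theorem unip_mulVec_of_pencilAt_eq_zero {v : Fin d → ℂ} {z : Fin n → ℂ}
    (h : ∀ j, pencilAt N (N j *ᵥ v) z = 0) : unip N z *ᵥ v = v - pencilAt N v z := by
  have h1 : (∑ j, z j • N j) *ᵥ ((∑ j, z j • N j) *ᵥ v) = 0 := by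
    have : (∑ j, z j • N j) *ᵥ v = ∑ j, z j • (N j *ᵥ v) := pencilAt_apply N v z
    rw [this, Matrix.mulVec_sum]
    refine Finset.sum_eq_zero fun j _ => ?_
    rw [Matrix.mulVec_smul]
    exact smul_eq_zero_of_right _ (h j)
  unfold unip
  rw [Matrix.exp_mulVec_of_mulVec_mulVec_eq_zero]
  · rw [Matrix.neg_mulVec, ← sub_eq_add_neg]; rfl
  · rw [Matrix.neg_mulVec, Matrix.neg_mulVec, Matrix.mulVec_neg, h1, neg_zero, neg_zero]

theorem pencilAt_mulVec (hN : ∀ i j, Commute (N i) (N j)) (j : Fin n) (z : Fin n → ℂ)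
    (v : Fin d → ℂ) : pencilAt N (N j *ᵥ v) z = N j *ᵥ pencilAt N v z := by
  rw [pencilAt_apply, pencilAt_apply, Matrix.mulVec_sum]
  refine Finset.sum_congr rfl fun i _ => ?_
  rw [Matrix.mulVec_smul, Matrix.mulVec_mulVec, Matrix.mulVec_mulVec, (hN i j).eq]

/-- The unipotent group element at `z` fixes `v` if its logarithm kills `v`. -/
theorem unip_mulVec_eq_self (hN : ∀ i j, Commute (N i) (N j)) {v : Fin d → ℂ} {z : Fin n → ℂ}
    (h : pencilAt N v z = 0) : unip N z *ᵥ v = v := by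
  rw [unip_mulVec_of_pencilAt_eq_zero, h, sub_zero]
  intro j
  rw [pencilAt_mulVec hN, h, Matrix.mulVec_zero]

variable (N) in
/-- The vectors killed by every product of `k` of the matrices `N_j`. -/
def killedBy : ℕ → Set (Fin d → ℂ)
  | 0 => {0}
  | k + 1 => {v | ∀ j, N j *ᵥ v ∈ killedBy k}

theorem zero_mem_killedBy (k : ℕ) : (0 : Fin d → ℂ) ∈ killedBy N k := by
  induction k with
  | zero => rfl
  | succ k ih => intro j; simpa using ih

theorem smul_mem_killedBy (k : ℕ) (a : ℂ) {v : Fin d → ℂ} (hv : v ∈ killedBy N k) :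
    a • v ∈ killedBy N k := by
  induction k generalizing v with
  | zero => rw [show v = 0 from hv, smul_zero]; rfl
  | succ k ih => intro j; rw [Matrix.mulVec_smul]; exact ih (hv j)

/-- If `N_j ^ e_j` kills `v` for every `j`, so does every product of more than `∑ e_j` factors:
applying one `N_j` lowers `e_j` by one. -/
theorem mem_killedBy_of_pow_mulVec_eq_zero (hN : ∀ i j, Commute (N i) (N j)) (k : ℕ)
    (e : Fin n → ℕ) (he : ∑ j, e j ≤ k) (v : Fin d → ℂ) (hv : ∀ j, N j ^ e j *ᵥ v = 0) :
    v ∈ killedBy N (k + 1) := by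
  induction k generalizing e v with
  | zero =>
    intro j
    have h0 : e j = 0 := by
      have := Finset.single_le_sum (f := e) (fun i _ => Nat.zero_le _) (Finset.mem_univ j)
      omega
    have hv0 : v = 0 := by simpa [h0] using hv j
    simpa [hv0] using zero_mem_killedBy 0
  | succ k ih =>
    intro j
    by_cases h0 : e j = 0
    · have hv0 : v = 0 := by simpa [h0] using hv j
      simpa [hv0] using zero_mem_killedBy _
    · refine ih (Function.update e j (e j - 1)) ?_ _ fun i => ?_
      · have h1 := Finset.add_sum_erase Finset.univ e (Finset.mem_univ j)
        have h2 := Finset.add_sum_erase Finset.univ (Function.update e j (e j - 1))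
          (Finset.mem_univ j)
        have h3 : ∑ x ∈ Finset.univ.erase j, Function.update e j (e j - 1) x =
            ∑ x ∈ Finset.univ.erase j, e x :=
          Finset.sum_congr rfl fun x hx => Function.update_of_ne (Finset.ne_of_mem_erase hx) _ _
        rw [Function.update_self] at h2
        omega
      · by_cases hij : i = j
        · subst hij
          rw [Function.update_self, Matrix.mulVec_mulVec, ← pow_succ, Nat.sub_add_cancel (by omega)]
          exact hv i
        · rw [Function.update_of_ne hij, Matrix.mulVec_mulVec, ((hN i j).pow_left _).eq,
            ← Matrix.mulVec_mulVec, hv i, Matrix.mulVec_zero]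

theorem exists_forall_mem_killedBy (hN : ∀ i j, Commute (N i) (N j))
    (hnil : ∀ j, IsNilpotent (N j)) : ∃ k, ∀ v, v ∈ killedBy N k :=
  ⟨_, fun v => mem_killedBy_of_pow_mulVec_eq_zero hN _ (fun _ => d) le_rfl v fun j => by
    rw [Matrix.pow_eq_zero_of_isNilpotent (hnil j), Matrix.zero_mulVec]⟩

/-- The parameter `z` can be recovered holomorphically from the point `e^{-zN} h` of the orbit,
up to the Lie algebra `{w | (∑ w_j N_j) h = 0}` of the stabilizer. By induction `z` is known up to
some `w` that kills all `N_j h`; for such `w` the orbit map is affine. -/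
theorem exists_orbit_section_of_mem_killedBy (hN : ∀ i j, Commute (N i) (N j)) (k : ℕ)
    {h : Fin d → ℂ} (hh : h ∈ killedBy N k) :
    ∃ σ : (Fin d → ℂ) → (Fin n → ℂ), Differentiable ℂ σ ∧
      ∀ z, pencilAt N h (σ (unip N z *ᵥ h)) = pencilAt N h z := by
  induction k generalizing h with
  | zero =>
    refine ⟨fun _ => 0, differentiable_const _, fun z => ?_⟩
    rw [show h = 0 from hh]
    simp [pencilAt_apply]
  | succ k ih =>
    choose σ hσ hσz using fun j => ih (hh j)
    set L : (Fin n → ℂ) →ₗ[ℂ] (Fin n → Fin d → ℂ) :=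
      LinearMap.pi fun j => pencilAt N (N j *ᵥ h) with hL
    obtain ⟨G, hG⟩ := L.exists_comp_comp_self
    obtain ⟨G', hG'⟩ := (pencilAt N h).exists_comp_comp_self
    have hlin : ∀ j, Differentiable ℂ fun v : Fin d → ℂ => N j *ᵥ v := fun j =>
      Matrix.differentiable_mulVec (fun _ _ => differentiable_const _) differentiable_id
    set τ : (Fin d → ℂ) → (Fin n → ℂ) :=
      fun v => G fun j => pencilAt N (N j *ᵥ h) (σ j (N j *ᵥ v)) with hτ
    have hτd : Differentiable ℂ τ := by
      refine (G.toContinuousLinearMap.differentiable).comp (differentiable_pi.2 fun j => ?_)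
      exact ((pencilAt N (N j *ᵥ h)).toContinuousLinearMap.differentiable).comp
        ((hσ j).comp (hlin j))
    refine ⟨fun v => τ v + G' (h - unip N (-τ v) *ᵥ v), ?_, fun z => ?_⟩
    · exact hτd.add (G'.toContinuousLinearMap.differentiable.comp
        ((differentiable_const _).sub (differentiable_unip_mulVec N hτd.neg differentiable_id)))
    · set v := unip N z *ᵥ h with hv
      have h1 : τ v = G (L z) := by
        simp only [hτ, hv]
        congr 1
        funext j
        rw [mulVec_unip_mulVec hN, hσz]
        rfl
      have h2 : ∀ j, pencilAt N (N j *ᵥ h) (z - τ v) = 0 := fun j => by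
        rw [h1, map_sub, sub_eq_zero]
        exact (congrFun (hG z) j).symm
      have h3 : unip N (-τ v) *ᵥ v = h - pencilAt N h (z - τ v) := by
        rw [hv, Matrix.mulVec_mulVec, ← unip_add hN, ← hv, ← unip_mulVec_of_pencilAt_eq_zero h2]
        congr 2; abel
      beta_reduce
      rw [h3, sub_sub_cancel, map_add, hG', map_sub]
      abel

theorem exists_orbit_section (hN : ∀ i j, Commute (N i) (N j)) (hnil : ∀ j, IsNilpotent (N j))
    (h : Fin d → ℂ) :
    ∃ σ : (Fin d → ℂ) → (Fin n → ℂ), Differentiable ℂ σ ∧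
      ∀ z, pencilAt N h (σ (unip N z *ᵥ h)) = pencilAt N h z := by
  obtain ⟨k, hk⟩ := exists_forall_mem_killedBy hN hnil
  exact exists_orbit_section_of_mem_killedBy hN k (hk h)

/-- The complex vector with the given integral coordinates. -/
def intVec (h : Fin d → ℤ) : Fin d → ℂ := fun k => (h k : ℂ)

theorem map_intCast_mulVec_intVec (M : Matrix (Fin d) (Fin d) ℤ) (h : Fin d → ℤ) :
    M.map (Int.cast : ℤ → ℂ) *ᵥ intVec h = intVec (M *ᵥ h) := by
  funext k
  simp [intVec, Matrix.mulVec, dotProduct]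

theorem finite_setOf_abs_le (C : ℝ) : {h : Fin d → ℤ | ∀ k, |(h k : ℝ)| ≤ C}.Finite := by
  refine (Set.finite_Icc (fun _ : Fin d => -⌈C⌉) (fun _ : Fin d => ⌈C⌉)).subset fun h hh => ?_
  have h1 : ∀ k, |h k| ≤ ⌈C⌉ := fun k => by
    have := (hh k).trans (Int.le_ceil C)
    exact_mod_cast this
  exact ⟨fun k => (abs_le.mp (h1 k)).1, fun k => (abs_le.mp (h1 k)).2⟩

/-- If `D N_j` is integral, then so are the coefficients of the linear equations that define the
stabilizer of an integral vector. -/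
theorem smul_pencilAt_intVec {D : ℕ} {M : Fin n → Matrix (Fin d) (Fin d) ℤ}
    (hM : ∀ j, (D : ℂ) • N j = (M j).map (Int.cast : ℤ → ℂ)) (h : Fin d → ℤ) (w : Fin n → ℂ) :
    (D : ℂ) • pencilAt N (intVec h) w = fun k => ∑ j, w j * (((M j *ᵥ h) k : ℤ) : ℂ) := by
  rw [pencilAt_apply, Finset.smul_sum]
  funext k
  rw [Finset.sum_apply]
  refine Finset.sum_congr rfl fun j _ => ?_
  rw [smul_comm, ← Matrix.smul_mulVec, hM, map_intCast_mulVec_intVec]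
  simp [intVec]

theorem pencilAt_ofReal_im_eq_zero {D : ℕ} (hD : D ≠ 0) {M : Fin n → Matrix (Fin d) (Fin d) ℤ}
    (hM : ∀ j, (D : ℂ) • N j = (M j).map (Int.cast : ℤ → ℂ)) {h : Fin d → ℤ} {z : Fin n → ℂ}
    (hz : pencilAt N (intVec h) z = 0) :
    pencilAt N (intVec h) (fun j => ((z j).im : ℂ)) = 0 := by
  have hDc : (D : ℂ) ≠ 0 := by exact_mod_cast hD
  have key := smul_pencilAt_intVec hM h
  have h1 := key z
  rw [hz, smul_zero] at h1
  have h2 : (D : ℂ) • pencilAt N (intVec h) (fun j => ((z j).im : ℂ)) = 0 := by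
    rw [key]
    funext k
    have h3 := congrArg Complex.im (congrFun h1 k)
    simp only [Pi.zero_apply, Complex.zero_im, Complex.im_sum] at h3
    have h4 : ∑ j, (z j).im * (((M j *ᵥ h) k : ℤ) : ℝ) = 0 := by
      rw [h3]
      exact Finset.sum_congr rfl fun j _ => by simp [Complex.mul_im]
    have := congrArg (Complex.ofReal) h4
    simpa using this
  exact (smul_eq_zero.mp h2).resolve_left hDc

end Orbit

/-! ### Integral vectors with bounded orbit points -/

section Lattice

variable {n d : ℕ} {N : Fin n → Matrix (Fin d) (Fin d) ℂ}

/-- The product of the unipotent matrix at a bounded parameter with a bounded vector is bounded. -/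
theorem exists_norm_unip_mulVec_le (N : Fin n → Matrix (Fin d) (Fin d) ℂ) (A R : ℝ) :
    ∃ C, ∀ (a : Fin n → ℂ) (v : Fin d → ℂ), ‖a‖ ≤ A → ‖v‖ ≤ R → ‖unip N a *ᵥ v‖ ≤ C := by
  have hc : Continuous fun p : (Fin n → ℂ) × (Fin d → ℂ) => unip N p.1 *ᵥ p.2 :=
    (differentiable_unip_mulVec N differentiable_fst differentiable_snd).continuous
  obtain ⟨C, hC⟩ := ((isCompact_closedBall (0 : Fin n → ℂ) A).prod
    (isCompact_closedBall (0 : Fin d → ℂ) R)).exists_bound_of_continuousOn hc.continuousOn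
  exact ⟨C, fun a v ha hv => hC (a, v) ⟨by simpa using ha, by simpa using hv⟩⟩

/-- Suppose that `N_j h` is a given vector for every `j`. Then `h` is bounded in terms of a bound
for `e^{-zN} h` with `re z` bounded: the section of the orbit map at `N_j h` shows that
`im z = w + O(1)` with `w` real and `(∑ w_i N_i) N_j h = 0` for all `j`, so that
`e^{-i wN} h = h - i (wN) h` is bounded, and `h` is its real part. -/
theorem finite_setOf_norm_unip_mulVec_le_of_mulVec_eq (hN : ∀ i j, Commute (N i) (N j))
    {D : ℕ} (hD : D ≠ 0) {M : Fin n → Matrix (Fin d) (Fin d) ℤ}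
    (hM : ∀ j, (D : ℂ) • N j = (M j).map (Int.cast : ℤ → ℂ)) {k : ℕ} (R : ℝ)
    (c : Fin n → Fin d → ℤ) (hc : ∀ j, intVec (c j) ∈ killedBy N k) :
    {h : Fin d → ℤ | (∀ j, M j *ᵥ h = c j) ∧
      ∃ z : Fin n → ℂ, (∀ j, |(z j).re| ≤ 1) ∧ ‖unip N z *ᵥ intVec h‖ ≤ R}.Finite := by
  have hDc : (D : ℂ) ≠ 0 := by exact_mod_cast hD
  choose σ hσ hσz using fun j => exists_orbit_section_of_mem_killedBy hN k (hc j)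
  set L : (Fin n → ℂ) →ₗ[ℂ] (Fin n → Fin d → ℂ) :=
    LinearMap.pi fun j => pencilAt N (intVec (c j)) with hL
  obtain ⟨G, hG⟩ := L.exists_comp_comp_self
  set b : (Fin d → ℂ) → (Fin n → ℂ) :=
    fun v => G fun j => pencilAt N (intVec (c j)) (σ j ((D : ℂ) • N j *ᵥ v)) with hb
  have hbc : Continuous b := by
    refine G.toContinuousLinearMap.continuous.comp (continuous_pi fun j => ?_)
    exact ((pencilAt N (intVec (c j))).toContinuousLinearMap.continuous).comp
      ((hσ j).continuous.comp ((continuous_const.matrix_mulVec continuous_id).const_smul (D : ℂ)))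
  obtain ⟨B, hB⟩ := (isCompact_closedBall (0 : Fin d → ℂ) R).exists_bound_of_continuousOn
    hbc.continuousOn
  obtain ⟨C, hC⟩ := exists_norm_unip_mulVec_le N (1 + B) R
  refine (finite_setOf_abs_le C).subset ?_
  rintro h ⟨hh, z, hz, hzR⟩
  set v := unip N z *ᵥ intVec h with hv
  have hDN : ∀ j, (D : ℂ) • (N j *ᵥ intVec h) = intVec (c j) := fun j => by
    rw [← Matrix.smul_mulVec, hM, map_intCast_mulVec_intVec, hh]
  have h1 : ∀ j, pencilAt N (intVec (c j)) (z - b v) = 0 := by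
    have : b v = G (L z) := by
      simp only [hb, hv]
      congr 1
      funext j
      rw [mulVec_unip_mulVec hN, ← Matrix.mulVec_smul, hDN, hσz]
      rfl
    intro j
    rw [this, map_sub, sub_eq_zero]
    exact (congrFun (hG z) j).symm
  -- the coefficients of these equations are real, so the imaginary part is a solution, too
  set w : Fin n → ℂ := fun j => (((z - b v) j).im : ℂ) with hw
  have h2 : ∀ j, pencilAt N (intVec (c j)) w = 0 := fun j =>
    pencilAt_ofReal_im_eq_zero hD hM (h1 j)
  have h3 : unip N (Complex.I • w) *ᵥ intVec h =
      intVec h - Complex.I • pencilAt N (intVec h) w := by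
    rw [unip_mulVec_of_pencilAt_eq_zero, map_smul]
    intro j
    have : N j *ᵥ intVec h = (D : ℂ)⁻¹ • intVec (c j) := by
      rw [← hDN, smul_smul, inv_mul_cancel₀ hDc, one_smul]
    have h4 : ∀ (a : ℂ) (x : Fin d → ℂ) (y : Fin n → ℂ),
        pencilAt N (a • x) y = a • pencilAt N x y := fun a x y => by
      simp [pencilAt, Matrix.mulVec_smul]
    rw [this, h4, map_smul, h2, smul_zero, smul_zero]
  have h4 : ‖unip N (Complex.I • w) *ᵥ intVec h‖ ≤ C := by
    have : unip N (Complex.I • w) *ᵥ intVec h = unip N (Complex.I • w - z) *ᵥ v := by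
      rw [hv, Matrix.mulVec_mulVec, ← unip_add hN, sub_add_cancel]
    rw [this]
    have hB0 : 0 ≤ B := (norm_nonneg _).trans (hB v (by simpa using hzR))
    refine hC _ _ ((pi_norm_le_iff_of_nonneg (by linarith)).2 fun j => ?_) hzR
    have hbj : |(b v j).im| ≤ B := (Complex.abs_im_le_norm _).trans
      ((norm_le_pi_norm (b v) j).trans (hB v (by simpa using hzR)))
    have : (Complex.I • w - z) j = -((z j).re : ℂ) - ((b v j).im : ℂ) * Complex.I := by
      apply Complex.ext <;> simp [hw]
    rw [this]
    refine (norm_sub_le _ _).trans ?_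
    simpa using add_le_add (hz j) hbj
  intro k
  have h5 : (((unip N (Complex.I • w) *ᵥ intVec h) k).re : ℝ) = (h k : ℝ) := by
    have h6 := congrFun (smul_pencilAt_intVec hM h w) k
    have h7 : (pencilAt N (intVec h) w k).im = 0 := by
      have h8 := congrArg Complex.im h6
      simp only [Pi.smul_apply, smul_eq_mul, Complex.im_sum, hw, Complex.mul_im, Complex.natCast_re,
        Complex.natCast_im, Complex.intCast_im, Complex.intCast_re, Complex.ofReal_im,
        Complex.ofReal_re, mul_zero, zero_mul, add_zero, Finset.sum_const_zero] at h8
      exact (mul_eq_zero.mp h8).resolve_left (by exact_mod_cast hD)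
    rw [h3]
    simp [intVec, h7]
  rw [← h5]
  exact (Complex.abs_re_le_norm _).trans ((norm_le_pi_norm _ k).trans h4)

/-- Only finitely many integral vectors `h` have `e^{-zN} h` in a given ball for some `z` with
bounded real part. No bound on the imaginary part of `z` is needed. -/
theorem finite_setOf_norm_unip_mulVec_le_of_mem_killedBy (hN : ∀ i j, Commute (N i) (N j))
    {D : ℕ} (hD : D ≠ 0) {M : Fin n → Matrix (Fin d) (Fin d) ℤ}
    (hM : ∀ j, (D : ℂ) • N j = (M j).map (Int.cast : ℤ → ℂ)) (k : ℕ) (R : ℝ) :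
    {h : Fin d → ℤ | intVec h ∈ killedBy N k ∧
      ∃ z : Fin n → ℂ, (∀ j, |(z j).re| ≤ 1) ∧ ‖unip N z *ᵥ intVec h‖ ≤ R}.Finite := by
  induction k generalizing R with
  | zero =>
    refine (Set.finite_singleton (0 : Fin d → ℤ)).subset fun h hh => ?_
    have h0 : intVec h = 0 := hh.1
    funext k
    simpa [intVec] using congrFun h0 k
  | succ k ih =>
    have hbd : ∃ R', ∀ (j : Fin n) (v : Fin d → ℂ), ‖v‖ ≤ R → ‖(D : ℂ) • N j *ᵥ v‖ ≤ R' := by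
      have hcont : Continuous fun v : Fin d → ℂ => fun j => (D : ℂ) • N j *ᵥ v :=
        continuous_pi fun j => (continuous_const.matrix_mulVec continuous_id).const_smul (D : ℂ)
      obtain ⟨R', hR'⟩ := (isCompact_closedBall (0 : Fin d → ℂ) R).exists_bound_of_continuousOn
        hcont.continuousOn
      exact ⟨R', fun j v hv => (norm_le_pi_norm (fun j => (D : ℂ) • N j *ᵥ v) j).trans
        (hR' v (by simpa using hv))⟩
    obtain ⟨R', hR'⟩ := hbd
    have hfin := Set.Finite.pi' fun _ : Fin n => ih R'
    refine (hfin.biUnion (t := fun c => {h : Fin d → ℤ | (∀ j, M j *ᵥ h = c j) ∧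
      ∃ z : Fin n → ℂ, (∀ j, |(z j).re| ≤ 1) ∧ ‖unip N z *ᵥ intVec h‖ ≤ R}) fun c hc =>
      finite_setOf_norm_unip_mulVec_le_of_mulVec_eq hN hD hM R c fun j => (hc j).1).subset ?_
    rintro h ⟨hk, z, hz, hzR⟩
    have hDN : ∀ j, intVec (M j *ᵥ h) = (D : ℂ) • (N j *ᵥ intVec h) := fun j => by
      rw [← Matrix.smul_mulVec, hM, map_intCast_mulVec_intVec]
    refine Set.mem_biUnion (x := fun j => M j *ᵥ h) (fun j => ⟨?_, z, hz, ?_⟩)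
      ⟨fun j => rfl, z, hz, hzR⟩
    · rw [hDN]; exact smul_mem_killedBy k _ (hk j)
    · rw [hDN, Matrix.mulVec_smul, ← mulVec_unip_mulVec hN]
      exact hR' j _ hzR

theorem finite_setOf_norm_unip_mulVec_le (hN : ∀ i j, Commute (N i) (N j))
    (hnil : ∀ j, IsNilpotent (N j)) {D : ℕ} (hD : D ≠ 0) {M : Fin n → Matrix (Fin d) (Fin d) ℤ}
    (hM : ∀ j, (D : ℂ) • N j = (M j).map (Int.cast : ℤ → ℂ)) (R : ℝ) :
    {h : Fin d → ℤ | ∃ z : Fin n → ℂ, (∀ j, |(z j).re| ≤ 1) ∧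
      ‖unip N z *ᵥ intVec h‖ ≤ R}.Finite := by
  obtain ⟨k, hk⟩ := exists_forall_mem_killedBy hN hnil
  exact (finite_setOf_norm_unip_mulVec_le_of_mem_killedBy hN hD hM k R).subset
    fun h hh => ⟨hk _, hh⟩

/-- Integral translations of the parameter preserve the lattice. -/
theorem exists_unip_intCast_mulVec_intVec (hN : ∀ i j, Commute (N i) (N j))
    {T : Fin n → Matrix (Fin d) (Fin d) ℤ} (hT : ∀ j, IsUnit (T j))
    (hexp : ∀ j, NormedSpace.exp (-N j) = (T j).map (Int.cast : ℤ → ℂ))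
    (m : Fin n → ℤ) (h : Fin d → ℤ) :
    ∃ h' : Fin d → ℤ, unip N (fun j => (m j : ℂ)) *ᵥ intVec h = intVec h' := by
  set P : (Fin n → ℂ) → Prop :=
    fun z => ∀ h : Fin d → ℤ, ∃ h' : Fin d → ℤ, unip N z *ᵥ intVec h = intVec h' with hP
  have h0 : P 0 := fun h => ⟨h, by rw [unip_zero, Matrix.one_mulVec]⟩
  have hadd : ∀ z w, P z → P w → P (z + w) := by
    intro z w hz hw h
    obtain ⟨h1, e1⟩ := hw h
    obtain ⟨h2, e2⟩ := hz h1
    exact ⟨h2, by rw [unip_add hN, ← Matrix.mulVec_mulVec, e1, e2]⟩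
  have hsingle : ∀ j, unip N (Pi.single j 1) = (T j).map (Int.cast : ℤ → ℂ) := by
    intro j
    rw [← hexp, unip, Finset.sum_eq_single j]
    · simp
    · intro i _ hij; simp [Pi.single_eq_of_ne hij]
    · simp
  have hp1 : ∀ j, P (Pi.single j 1) := fun j h => ⟨T j *ᵥ h, by
    rw [hsingle, map_intCast_mulVec_intVec]⟩
  have hm1 : ∀ j, P (-Pi.single j 1) := fun j h => by
    obtain ⟨u, hu⟩ := hT j
    refine ⟨(↑u⁻¹ : Matrix (Fin d) (Fin d) ℤ) *ᵥ h, ?_⟩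
    have h1 : h = T j *ᵥ ((↑u⁻¹ : Matrix (Fin d) (Fin d) ℤ) *ᵥ h) := by
      rw [Matrix.mulVec_mulVec, ← hu, Units.mul_inv, Matrix.one_mulVec]
    conv_lhs => rw [h1, ← map_intCast_mulVec_intVec, ← hsingle]
    exact unip_neg_mulVec_unip_mulVec hN _ _
  have hz : ∀ (j : Fin n) (a : ℤ), P ((a : ℂ) • Pi.single j 1) := by
    intro j a
    induction a using Int.induction_on with
    | zero => simpa using h0
    | succ a ih =>
      have := hadd _ _ ih (hp1 j)
      convert this using 1
      push_cast; rw [add_smul, one_smul]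
    | pred a ih =>
      have := hadd _ _ ih (hm1 j)
      convert this using 1
      push_cast; rw [sub_smul, one_smul, sub_eq_add_neg]
  have hsum : (fun j => (m j : ℂ)) = ∑ j, (m j : ℂ) • (Pi.single j 1 : Fin n → ℂ) := by
    funext i
    simp [Finset.sum_apply, Pi.single_apply]
  have : P (fun j => (m j : ℂ)) := by
    rw [hsum]
    exact Finset.sum_induction _ P (fun _ _ => hadd _ _) h0 fun j _ => hz j (m j)
  exact this h

end Lattice

/-! ### Closures of subtori of the complex torus -/

/-- Farkas' lemma: a linear functional that is nonnegative wherever finitely many given ones are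
is a nonnegative combination of them. By induction on the number of functionals: if `a_j` is needed,
there is `x₀` with `b x₀ < 0`, `a_j x₀ = -1` at which the other functionals are nonnegative, and the
projection along `x₀` to the kernel of `a_j` removes `a_j`. -/
theorem exists_nonneg_combination {ι V : Type*} [AddCommGroup V] [Module ℚ V]
    (s : Finset ι) (a : ι → V →ₗ[ℚ] ℚ) (b : V →ₗ[ℚ] ℚ)
    (h : ∀ x, (∀ i ∈ s, 0 ≤ a i x) → 0 ≤ b x) :
    ∃ c : ι → ℚ, (∀ i, 0 ≤ c i) ∧ ∀ x, b x = ∑ i ∈ s, c i * a i x := by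
  classical
  induction s using Finset.induction_on generalizing a b with
  | empty =>
    refine ⟨0, fun _ => le_rfl, fun x => ?_⟩
    have h1 := h x (by simp)
    have h2 := h (-x) (by simp)
    rw [map_neg] at h2
    simp; linarith
  | insert j s hj ih =>
    by_cases hb : ∀ x, (∀ i ∈ s, 0 ≤ a i x) → 0 ≤ b x
    · obtain ⟨c, hc, hcb⟩ := ih a b hb
      refine ⟨Function.update c j 0, fun i => ?_, fun x => ?_⟩
      · by_cases hij : i = j
        · subst hij; simp
        · simpa [Function.update_of_ne hij] using hc i
      · rw [Finset.sum_insert hj, Function.update_self, zero_mul, zero_add, hcb]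
        exact Finset.sum_congr rfl fun i hi => by
          rw [Function.update_of_ne (ne_of_mem_of_not_mem hi hj)]
    · push Not at hb
      obtain ⟨y, hy, hby⟩ := hb
      have hay : a j y < 0 := by
        by_contra hcon
        push Not at hcon
        refine absurd (h y fun i hi => ?_) (not_le.2 hby)
        rcases Finset.mem_insert.1 hi with rfl | hi
        · exact hcon
        · exact hy i hi
      set x₀ := (-(a j y))⁻¹ • y with hx₀
      have hpos : 0 < (-(a j y))⁻¹ := by rw [inv_pos]; linarith
      have hjx : a j x₀ = -1 := by
        rw [hx₀, map_smul, smul_eq_mul, inv_neg, neg_mul, inv_mul_cancel₀ hay.ne]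
      have hsx : ∀ i ∈ s, 0 ≤ a i x₀ := fun i hi => by
        rw [hx₀, map_smul, smul_eq_mul]; exact mul_nonneg hpos.le (hy i hi)
      have hbx : b x₀ < 0 := by
        rw [hx₀, map_smul, smul_eq_mul]; exact mul_neg_of_pos_of_neg hpos hby
      obtain ⟨c, hc, hcb⟩ := ih (fun i => a i + a i x₀ • a j) (b + b x₀ • a j) (by
        intro x hx
        have h1 : ∀ f : V →ₗ[ℚ] ℚ, (f + f x₀ • a j) x = f (x + a j x • x₀) := fun f => by
          simp; ring
        rw [h1]
        refine h _ fun i hi => ?_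
        rcases Finset.mem_insert.1 hi with rfl | hi
        · rw [map_add, map_smul, hjx]; simp
        · rw [← h1]; exact hx i hi)
      refine ⟨Function.update c j (∑ i ∈ s, c i * a i x₀ - b x₀), fun i => ?_, fun x => ?_⟩
      · by_cases hij : i = j
        · subst hij
          rw [Function.update_self]
          have := Finset.sum_nonneg fun i hi => mul_nonneg (hc i) (hsx i hi)
          linarith
        · simpa [Function.update_of_ne hij] using hc i
      · rw [Finset.sum_insert hj, Function.update_self]
        have h1 : ∑ i ∈ s, Function.update c j (∑ i ∈ s, c i * a i x₀ - b x₀) i * a i x =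
            ∑ i ∈ s, c i * a i x :=
          Finset.sum_congr rfl fun i hi => by
            rw [Function.update_of_ne (ne_of_mem_of_not_mem hi hj)]
        have h2 := hcb x
        simp only [LinearMap.add_apply, LinearMap.smul_apply, smul_eq_mul, mul_add,
          Finset.sum_add_distrib] at h2
        have h3 : ∑ i ∈ s, c i * (a i x₀ * a j x) = (∑ i ∈ s, c i * a i x₀) * a j x := by
          rw [Finset.sum_mul]; exact Finset.sum_congr rfl fun i _ => by ring
        rw [h1]
        rw [h3] at h2
        linear_combination h2

theorem Matrix.exists_mul_mul_self {K m n : Type*} [Field K] [Fintype m] [Fintype n]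
    [DecidableEq m] [DecidableEq n] (P : Matrix m n K) : ∃ G : Matrix n m K, P * G * P = P := by
  obtain ⟨g, hg⟩ := P.mulVecLin.exists_comp_comp_self
  refine ⟨LinearMap.toMatrix' g, ?_⟩
  refine Matrix.toLin'.injective (LinearMap.ext fun x => ?_)
  have := hg x
  simp only [Matrix.mulVecLin_apply] at this
  rw [Matrix.toLin'_apply, Matrix.toLin'_apply, ← Matrix.mulVec_mulVec, ← Matrix.mulVec_mulVec,
    LinearMap.toMatrix'_mulVec, this]

theorem exists_intCast_eq_natCast_mul {n : ℕ} (a : Fin n → ℚ) :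
    ∃ (D : ℕ) (a' : Fin n → ℤ), 0 < D ∧ ∀ j, (a' j : ℚ) = D * a j := by
  refine ⟨∏ j, (a j).den, fun j => (a j).num * ∏ i ∈ Finset.univ.erase j, ((a i).den : ℤ),
    Finset.prod_pos fun j _ => (a j).den_pos, fun j => ?_⟩
  rw [← Finset.mul_prod_erase _ _ (Finset.mem_univ j)]
  push_cast
  nth_rewrite 3 [← Rat.num_div_den (a j)]
  have : ((a j).den : ℚ) ≠ 0 := by exact_mod_cast (a j).den_nz
  field_simp

/-- A homomorphism to `ℤ` from a saturated sublattice of `ℤ^n` extends to `ℤ^n`. -/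
theorem exists_int_dotProduct_eq {n : ℕ} (A : Submodule ℤ (Fin n → ℤ))
    (hA : ∀ (k : ℤ) (a : Fin n → ℤ), k ≠ 0 → k • a ∈ A → a ∈ A) (z : Fin n → ℂ)
    (hz : ∀ a ∈ A, ∃ q : ℤ, ∑ j, (a j : ℂ) * z j = q) :
    ∃ m : Fin n → ℤ, ∀ a ∈ A, ∑ j, (a j : ℂ) * z j = ∑ j, (a j : ℂ) * m j := by
  have htf : Module.IsTorsionFree ℤ ((Fin n → ℤ) ⧸ A) := by
    rw [Module.isTorsionFree_iff_smul_eq_zero]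
    intro k x hkx
    obtain ⟨a, rfl⟩ := A.mkQ_surjective x
    by_cases hk : k = 0
    · exact Or.inl hk
    · right
      rw [← map_smul, ← LinearMap.mem_ker, A.ker_mkQ] at hkx
      rw [← LinearMap.mem_ker, A.ker_mkQ]
      exact hA k a hk hkx
  have hfree : Module.Free ℤ ((Fin n → ℤ) ⧸ A) := inferInstance
  obtain ⟨g, hg⟩ := A.mkQ.exists_rightInverse_of_surjective A.range_mkQ
  choose q hq using fun a : A => hz a a.2
  set φ : A →ₗ[ℤ] ℤ := AddMonoidHom.toIntLinearMap
    { toFun := q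
      map_zero' := by
        have := hq 0
        simp only [Submodule.coe_zero, Pi.zero_apply, Int.cast_zero, zero_mul,
          Finset.sum_const_zero] at this
        exact_mod_cast this.symm
      map_add' := fun a b => by
        have := hq (a + b)
        simp only [Submodule.coe_add, Pi.add_apply, Int.cast_add, add_mul,
          Finset.sum_add_distrib, hq] at this
        exact_mod_cast this.symm } with hφ
  set p : (Fin n → ℤ) →ₗ[ℤ] (Fin n → ℤ) := LinearMap.id - g ∘ₗ A.mkQ with hp
  have hmem : ∀ x, p x ∈ A := by
    intro x
    rw [← A.ker_mkQ, LinearMap.mem_ker]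
    have := LinearMap.congr_fun hg (A.mkQ x)
    simp only [hp, LinearMap.sub_apply, LinearMap.comp_apply, LinearMap.id_apply, map_sub] at this ⊢
    rw [this, sub_self]
  set ψ : (Fin n → ℤ) →ₗ[ℤ] ℤ := φ ∘ₗ p.codRestrict A hmem with hψ
  refine ⟨fun j => ψ (Pi.single j 1), fun a ha => ?_⟩
  have h1 : ψ a = q ⟨a, ha⟩ := by
    have h2 : A.mkQ a = 0 := by rw [← LinearMap.mem_ker, A.ker_mkQ]; exact ha
    have h3 : p.codRestrict A hmem a = ⟨a, ha⟩ := by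
      apply Subtype.ext
      simp only [hp, LinearMap.codRestrict_apply, LinearMap.sub_apply, LinearMap.comp_apply, h2,
        LinearMap.id_apply, map_zero, sub_zero]
    rw [hψ, LinearMap.comp_apply, h3]; rfl
  have h4 : ψ a = ∑ j, a j * ψ (Pi.single j 1) := by
    conv_lhs => rw [pi_eq_sum_univ' a]
    rw [map_sum]
    refine Finset.sum_congr rfl fun j _ => ?_
    rw [map_smul, smul_eq_mul]
  have h5 := hq ⟨a, ha⟩
  rw [h5, ← h1, h4]
  push_cast
  rfl

section Torus

variable {n d : ℕ}

/-- The complex kernel of an integral matrix. -/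
def complexKer (B : Matrix (Fin d) (Fin n) ℤ) : Set (Fin n → ℂ) :=
  {z | ∀ k, ∑ j, z j * (B k j : ℂ) = 0}

/-- The lattice of integral linear forms that vanish on the kernel of `B`. -/
def relationLattice (B : Matrix (Fin d) (Fin n) ℤ) : Submodule ℤ (Fin n → ℤ) where
  carrier := {a | ∀ z ∈ complexKer B, ∑ j, (a j : ℂ) * z j = 0}
  zero_mem' z _ := by simp
  add_mem' ha hb z hz := by
    simp [add_mul, Finset.sum_add_distrib, ha z hz, hb z hz]
  smul_mem' k a ha z hz := by
    simp [mul_assoc, ← Finset.mul_sum, ha z hz]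

/-- The common zero set in `ℂ^n` of the binomials `∏ s_j^{a_j⁺} - ∏ s_j^{a_j⁻}` for the relations
`a` of the subtorus `exp (2πi ker B)`: the toric variety that is the closure of the subtorus. -/
def binomialVariety (B : Matrix (Fin d) (Fin n) ℤ) : Set (Fin n → ℂ) :=
  {s | ∀ a ∈ relationLattice B, ∏ j, s j ^ (a j).toNat = ∏ j, s j ^ (-a j).toNat}

/-- The coordinatewise exponential `z ↦ (e^{2πi z_j})_j`. -/
def torusExp (z : Fin n → ℂ) : Fin n → ℂ :=
  fun j => Complex.exp (2 * Real.pi * Complex.I * z j)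

theorem torusExp_ne_zero (z : Fin n → ℂ) (j : Fin n) : torusExp z j ≠ 0 := Complex.exp_ne_zero _

theorem torusExp_add (z w : Fin n → ℂ) : torusExp (z + w) = torusExp z * torusExp w := by
  funext j
  simp [torusExp, mul_add, Complex.exp_add]

theorem torusExp_intCast (m : Fin n → ℤ) : torusExp (fun j => (m j : ℂ)) = 1 := by
  funext j
  exact Complex.exp_eq_one_iff.2 ⟨m j, by ring⟩

theorem differentiable_torusExp : Differentiable ℂ (torusExp : (Fin n → ℂ) → _) :=
  differentiable_pi.2 fun j => ((differentiable_apply j).const_mul _).cexp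

theorem exists_torusExp_apply_eq (s : Fin n → ℂ) :
    ∃ z, ∀ j, s j ≠ 0 → torusExp z j = s j := by
  refine ⟨fun j => Complex.log (s j) / (2 * Real.pi * Complex.I), fun j hj => ?_⟩
  rw [torusExp, mul_div_cancel₀ _ Complex.two_pi_I_ne_zero, Complex.exp_log hj]

theorem torusExp_eq_iff {z w : Fin n → ℂ} :
    torusExp z = torusExp w ↔ ∃ m : Fin n → ℤ, w = z + fun j => (m j : ℂ) := by
  constructor
  · intro h
    have h1 : ∀ j, ∃ m : ℤ, w j = z j + m := by
      intro j
      obtain ⟨m, hm⟩ := Complex.exp_eq_exp_iff_exists_int.1 (congrFun h j).symm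
      refine ⟨m, mul_left_cancel₀ Complex.two_pi_I_ne_zero ?_⟩
      rw [hm]; ring
    choose m hm using h1
    exact ⟨m, funext hm⟩
  · rintro ⟨m, rfl⟩
    rw [torusExp_add, torusExp_intCast, mul_one]

theorem prod_torusExp_pow (z : Fin n → ℂ) (p : Fin n → ℕ) :
    ∏ j, torusExp z j ^ p j = Complex.exp (2 * Real.pi * Complex.I * ∑ j, (p j : ℂ) * z j) := by
  rw [Finset.mul_sum, Complex.exp_sum]
  refine Finset.prod_congr rfl fun j _ => ?_
  rw [torusExp, ← Complex.exp_nat_mul]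
  congr 1; ring

theorem sum_toNat_sub_sum_toNat (a : Fin n → ℤ) (z : Fin n → ℂ) :
    ∑ j, ((a j).toNat : ℂ) * z j - ∑ j, ((-a j).toNat : ℂ) * z j = ∑ j, (a j : ℂ) * z j := by
  rw [← Finset.sum_sub_distrib]
  refine Finset.sum_congr rfl fun j _ => ?_
  rw [← sub_mul]
  congr 1
  have : ((a j).toNat : ℤ) - ((-a j).toNat : ℤ) = a j := by omega
  exact_mod_cast congrArg (Int.cast : ℤ → ℂ) this

theorem torusExp_mem_binomialVariety {B : Matrix (Fin d) (Fin n) ℤ} {z : Fin n → ℂ}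
    (hz : z ∈ complexKer B) : torusExp z ∈ binomialVariety B := by
  intro a ha
  have h := sum_toNat_sub_sum_toNat a z
  rw [ha z hz, sub_eq_zero] at h
  rw [prod_torusExp_pow, prod_torusExp_pow, h]

theorem isClosed_binomialVariety (B : Matrix (Fin d) (Fin n) ℤ) :
    IsClosed (binomialVariety B) := by
  have : binomialVariety B = ⋂ a ∈ relationLattice B,
      {s | ∏ j, s j ^ (a j).toNat = ∏ j, s j ^ (-a j).toNat} := by
    ext s; simp [binomialVariety]
  rw [this]
  exact isClosed_biInter fun a _ => isClosed_eq (by fun_prop) (by fun_prop)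

theorem mul_mem_binomialVariety {B : Matrix (Fin d) (Fin n) ℤ} {s t : Fin n → ℂ}
    (hs : s ∈ binomialVariety B) (ht : t ∈ binomialVariety B) : s * t ∈ binomialVariety B := by
  intro a ha
  simp only [Pi.mul_apply, mul_pow, Finset.prod_mul_distrib, hs a ha, ht a ha]

theorem sum_vecMul_mul (B : Matrix (Fin d) (Fin n) ℤ) (r : Fin d → ℚ) (z : Fin n → ℂ) :
    ∑ j, (((r ᵥ* B.map (Int.cast : ℤ → ℚ)) j : ℚ) : ℂ) * z j =
      ∑ k, (r k : ℂ) * ∑ j, z j * (B k j : ℂ) := by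
  simp only [Matrix.vecMul, dotProduct, Matrix.map_apply, Rat.cast_sum, Rat.cast_mul,
    Rat.cast_intCast, Finset.sum_mul, Finset.mul_sum]
  rw [Finset.sum_comm]
  exact Finset.sum_congr rfl fun k _ => Finset.sum_congr rfl fun j _ => by ring

/-- The matrix `B` with the columns outside `J` replaced by zero. -/
def restrictCols (B : Matrix (Fin d) (Fin n) ℤ) (J : Set (Fin n)) : Matrix (Fin d) (Fin n) ℚ :=
  open Classical in Matrix.of fun k j => if j ∈ J then (B k j : ℚ) else 0

theorem vecMul_restrictCols_of_mem (B : Matrix (Fin d) (Fin n) ℤ) {J : Set (Fin n)} {j : Fin n}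
    (hj : j ∈ J) (r : Fin d → ℚ) :
    (r ᵥ* restrictCols B J) j = (r ᵥ* B.map (Int.cast : ℤ → ℚ)) j := by
  simp [Matrix.vecMul, dotProduct, restrictCols, hj]

theorem vecMul_restrictCols_of_notMem (B : Matrix (Fin d) (Fin n) ℤ) {J : Set (Fin n)} {j : Fin n}
    (hj : j ∉ J) (r : Fin d → ℚ) : (r ᵥ* restrictCols B J) j = 0 := by
  simp [Matrix.vecMul, dotProduct, restrictCols, hj]

/-- A positive integral multiple of a rational combination of the rows of `B` is a relation. -/
theorem exists_mem_relationLattice (B : Matrix (Fin d) (Fin n) ℤ) (r : Fin d → ℚ) :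
    ∃ (D : ℕ) (a : Fin n → ℤ), 0 < D ∧ a ∈ relationLattice B ∧
      ∀ j, (a j : ℚ) = D * (r ᵥ* B.map (Int.cast : ℤ → ℚ)) j := by
  obtain ⟨D, a, hD, ha⟩ := exists_intCast_eq_natCast_mul (r ᵥ* B.map (Int.cast : ℤ → ℚ))
  refine ⟨D, a, hD, fun z hz => ?_, ha⟩
  have h1 : ∀ j, (a j : ℂ) = (D : ℂ) * (((r ᵥ* B.map (Int.cast : ℤ → ℚ)) j : ℚ) : ℂ) :=
    fun j => by exact_mod_cast congrArg (Rat.cast : ℚ → ℂ) (ha j)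
  simp only [h1, mul_assoc]
  rw [← Finset.mul_sum, sum_vecMul_mul]
  simp [hz _]

/-- A complex vector that is annihilated by the relations supported outside `J` agrees outside `J`
with an element of the kernel of `B`. -/
theorem exists_mem_complexKer_eq_of_notMem (B : Matrix (Fin d) (Fin n) ℤ) (J : Set (Fin n))
    (y : Fin n → ℂ)
    (hy : ∀ a ∈ relationLattice B, (∀ j ∈ J, a j = 0) → ∑ j, (a j : ℂ) * y j = 0) :
    ∃ z ∈ complexKer B, ∀ j ∉ J, z j = y j := by
  classical
  obtain ⟨G, hG⟩ := (restrictCols B J).exists_mul_mul_self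
  set b : Fin d → ℂ := fun k => ∑ j, y j * (B k j : ℂ) with hb
  set x : Fin n → ℂ := fun j => ∑ k, (G j k : ℂ) * b k with hx
  -- each row of `P G - 1`, with `P` the restricted matrix, annihilates `b`
  have hrow : ∀ r : Fin d → ℚ, r ᵥ* restrictCols B J = 0 → ∑ k, (r k : ℂ) * b k = 0 := by
    intro r hr
    obtain ⟨D, a, hD, ha, haD⟩ := exists_mem_relationLattice B r
    have h1 : ∑ j, (a j : ℂ) * y j = 0 := hy a ha fun j hj => by
      have := haD j
      rw [← vecMul_restrictCols_of_mem B hj, hr, Pi.zero_apply, mul_zero] at this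
      exact_mod_cast this
    have h2 : ∀ j, (a j : ℂ) = (D : ℂ) * (((r ᵥ* B.map (Int.cast : ℤ → ℚ)) j : ℚ) : ℂ) :=
      fun j => by exact_mod_cast congrArg (Rat.cast : ℚ → ℂ) (haD j)
    simp only [h2, mul_assoc] at h1
    rw [← Finset.mul_sum, sum_vecMul_mul] at h1
    exact (mul_eq_zero.mp h1).resolve_left (by exact_mod_cast hD.ne')
  have hPG : ∀ k, ∑ j, ((restrictCols B J k j : ℚ) : ℂ) * x j = b k := by
    intro k
    set Q : Matrix (Fin d) (Fin d) ℚ := restrictCols B J * G - 1 with hQ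
    have h1 := hrow (fun i => Q k i) (by
      have h0 : Q * restrictCols B J = 0 := by
        rw [hQ, Matrix.sub_mul, hG, Matrix.one_mul, sub_self]
      exact funext fun j => congrFun (congrFun h0 k) j)
    simp only [hQ, Matrix.sub_apply, Rat.cast_sub, sub_mul, Finset.sum_sub_distrib, Matrix.one_apply,
      Matrix.mul_apply, Rat.cast_sum, Rat.cast_mul] at h1
    simp only [apply_ite (Rat.cast : ℚ → ℂ), Rat.cast_one, Rat.cast_zero, ite_mul, one_mul,
      zero_mul, Finset.sum_ite_eq, Finset.mem_univ, if_true, sub_eq_zero] at h1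
    rw [← h1]
    simp only [hx, Finset.mul_sum, Finset.sum_mul]
    rw [Finset.sum_comm]
    exact Finset.sum_congr rfl fun i _ => Finset.sum_congr rfl fun j _ => by ring
  refine ⟨fun j => y j - if j ∈ J then x j else 0, fun k => ?_, fun j hj => by simp [hj]⟩
  have h1 : ∑ j, (if j ∈ J then x j else 0) * (B k j : ℂ) = b k := by
    rw [← hPG k]
    refine Finset.sum_congr rfl fun j _ => ?_
    by_cases hj : j ∈ J <;> simp [restrictCols, hj, mul_comm]
  simp only [sub_mul, Finset.sum_sub_distrib, h1]
  exact sub_self _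

/-- The nonzero coordinates of a point of the variety are those of a point of the subtorus. -/
theorem exists_mem_complexKer_torusExp_apply_eq {B : Matrix (Fin d) (Fin n) ℤ} {s : Fin n → ℂ}
    (hs : s ∈ binomialVariety B) :
    ∃ z ∈ complexKer B, ∀ j, s j ≠ 0 → torusExp z j = s j := by
  obtain ⟨z, hz⟩ := exists_torusExp_apply_eq s
  set A : Submodule ℤ (Fin n → ℤ) :=
    { carrier := {a | a ∈ relationLattice B ∧ ∀ j, s j = 0 → a j = 0}
      zero_mem' := ⟨zero_mem _, fun _ _ => rfl⟩
      add_mem' := fun ha hb => ⟨add_mem ha.1 hb.1, fun j hj => by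
        simp [ha.2 j hj, hb.2 j hj]⟩
      smul_mem' := fun k a ha => ⟨Submodule.smul_mem _ k ha.1, fun j hj => by
        simp [ha.2 j hj]⟩ } with hA
  obtain ⟨m, hm⟩ := exists_int_dotProduct_eq A (by
      rintro k a hk ⟨h1, h2⟩
      refine ⟨fun w hw => ?_, fun j hj => ?_⟩
      · have := h1 w hw
        simp only [Pi.smul_apply, smul_eq_mul, Int.cast_mul, mul_assoc, ← Finset.mul_sum] at this
        exact (mul_eq_zero.mp this).resolve_left (by exact_mod_cast hk)
      · have := h2 j hj
        simpa [hk] using this) z (by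
      rintro a ⟨h1, h2⟩
      have h3 := hs a h1
      have h4 : ∀ p : Fin n → ℕ, (∀ j, s j = 0 → p j = 0) →
          ∏ j, s j ^ p j = ∏ j, torusExp z j ^ p j := fun p hp =>
        Finset.prod_congr rfl fun j _ => by
          by_cases hj : s j = 0
          · simp [hp j hj]
          · rw [hz j hj]
      rw [h4 _ fun j hj => by simp [h2 j hj], h4 _ fun j hj => by simp [h2 j hj],
        prod_torusExp_pow, prod_torusExp_pow, Complex.exp_eq_exp_iff_exists_int] at h3
      obtain ⟨q, hq⟩ := h3
      refine ⟨q, mul_left_cancel₀ Complex.two_pi_I_ne_zero ?_⟩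
      rw [← sum_toNat_sub_sum_toNat]
      linear_combination hq)
  obtain ⟨w, hw, hwz⟩ := exists_mem_complexKer_eq_of_notMem B {j | s j = 0}
    (z - fun j => (m j : ℂ)) (fun a ha haJ => by
      have := hm a ⟨ha, haJ⟩
      simp only [Pi.sub_apply, mul_sub, Finset.sum_sub_distrib, this, sub_self])
  refine ⟨w, hw, fun j hj => ?_⟩
  have h1 : torusExp (z - fun j => (m j : ℂ)) = torusExp z :=
    (torusExp_eq_iff.2 ⟨m, by simp⟩)
  rw [← hz j hj, ← h1]
  simp only [torusExp]
  rw [hwz j hj]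

/-- The point where the coordinates in `J` vanish can be reached inside the subtorus: there is a
real one-parameter subgroup contracting exactly the coordinates that vanish at `s`. Otherwise
Farkas' lemma yields a relation whose binomial does not vanish at `s`. -/
theorem exists_mem_complexKer_pos {B : Matrix (Fin d) (Fin n) ℤ} {s : Fin n → ℂ}
    (hs : s ∈ binomialVariety B) :
    ∃ w : Fin n → ℚ, (fun j => (w j : ℂ)) ∈ complexKer B ∧
      (∀ j, s j = 0 → 0 < w j) ∧ ∀ j, s j ≠ 0 → w j = 0 := by
  classical
  set J : Set (Fin n) := {j | s j = 0} with hJ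
  set W : Submodule ℚ (Fin n → ℚ) :=
    { carrier := {w | (∀ k, ∑ j, w j * (B k j : ℚ) = 0) ∧ ∀ j ∉ J, w j = 0}
      zero_mem' := ⟨fun _ => by simp, fun _ _ => rfl⟩
      add_mem' := fun ha hb => ⟨fun k => by
        simp [add_mul, Finset.sum_add_distrib, ha.1 k, hb.1 k], fun j hj => by
        simp [ha.2 j hj, hb.2 j hj]⟩
      smul_mem' := fun c a ha => ⟨fun k => by
        simp [mul_assoc, ← Finset.mul_sum, ha.1 k], fun j hj => by simp [ha.2 j hj]⟩ } with hW
  have key : ∀ j₀ ∈ J, ∃ w ∈ W, (∀ j, 0 ≤ w j) ∧ 0 < w j₀ := by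
    intro j₀ hj₀
    by_contra hcon
    push Not at hcon
    obtain ⟨c, hc, hcb⟩ := exists_nonneg_combination (V := W) Finset.univ
      (fun j => LinearMap.proj j ∘ₗ W.subtype) (-(LinearMap.proj j₀ ∘ₗ W.subtype)) (by
        intro x hx
        have := hcon x x.2 fun j => hx j (Finset.mem_univ j)
        simpa using this)
    -- the functional `e` is nonnegative, positive at `j₀`, vanishes on `W` and outside `J`
    set e : Fin n → ℚ := fun j => if j ∈ J then c j + (if j = j₀ then 1 else 0) else 0 with he
    have heW : ∀ w ∈ W, ∑ j, e j * w j = 0 := by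
      intro w hw
      have h1 := hcb ⟨w, hw⟩
      simp only [LinearMap.neg_apply, LinearMap.comp_apply, Submodule.subtype_apply,
        LinearMap.proj_apply] at h1
      have h2 : ∑ j, e j * w j = ∑ j, (c j * w j + if j = j₀ then w j else 0) := by
        refine Finset.sum_congr rfl fun j _ => ?_
        by_cases hj : j ∈ J
        · simp only [he, hj, if_true, add_mul, ite_mul, one_mul, zero_mul]
        · simp [he, hj, hw.2 j hj]
      rw [h2, Finset.sum_add_distrib, ← h1]
      simp
    obtain ⟨G, hG⟩ := (restrictCols B J).exists_mul_mul_self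
    -- hence `e` is a combination of the rows of the restricted matrix
    have heP : (e ᵥ* G) ᵥ* restrictCols B J = e := by
      funext i
      by_cases hi : i ∈ J
      · set x : Fin n → ℚ := Pi.single i 1 - (G * restrictCols B J) *ᵥ Pi.single i 1 with hx
        have hPx : restrictCols B J *ᵥ x = 0 := by
          rw [hx, Matrix.mulVec_sub, Matrix.mulVec_mulVec, ← Matrix.mul_assoc, hG, sub_self]
        have hxW : (fun j => if j ∈ J then x j else 0) ∈ W := by
          refine ⟨fun k => ?_, fun j hj => by simp [hj]⟩
          refine Eq.trans ?_ (congrFun hPx k)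
          refine Finset.sum_congr rfl fun j _ => ?_
          by_cases hj : j ∈ J <;> simp [restrictCols, hj, mul_comm]
        have h1 := heW _ hxW
        have h2 : ∑ j, e j * (if j ∈ J then x j else 0) = e ⬝ᵥ x := by
          refine Finset.sum_congr rfl fun j _ => ?_
          by_cases hj : j ∈ J <;> simp [he, hj]
        rw [h2, hx, dotProduct_sub, Matrix.dotProduct_mulVec, sub_eq_zero,
          dotProduct_single, dotProduct_single, mul_one, mul_one] at h1
        rw [Matrix.vecMul_vecMul, ← h1]
      · rw [vecMul_restrictCols_of_notMem B hi]
        simp [he, hi]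
    obtain ⟨D, a, hD, ha, haD⟩ := exists_mem_relationLattice B (e ᵥ* G)
    have haJ : ∀ j ∈ J, (a j : ℚ) = D * e j := fun j hj => by
      rw [haD, ← vecMul_restrictCols_of_mem B hj, heP]
    have hDq : (0 : ℚ) < D := by exact_mod_cast hD
    have h0 : ∀ j ∈ J, 0 ≤ a j := fun j hj => by
      have h1 : 0 ≤ e j := by
        simp only [he, hj, if_true]
        exact add_nonneg (hc j) (by split_ifs <;> norm_num)
      have h2 : (0 : ℚ) ≤ a j := by rw [haJ j hj]; exact mul_nonneg hDq.le h1
      exact_mod_cast h2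
    have hpos : 0 < a j₀ := by
      have h1 : 0 < e j₀ := by
        simp only [he, hj₀, if_true]
        linarith [hc j₀]
      have h2 : (0 : ℚ) < a j₀ := by rw [haJ j₀ hj₀]; exact mul_pos hDq h1
      exact_mod_cast h2
    have h3 := hs a ha
    have h4 : ∏ j, s j ^ (a j).toNat = 0 :=
      Finset.prod_eq_zero (Finset.mem_univ j₀) (by
        rw [show s j₀ = 0 from hj₀, zero_pow (by omega)])
    have h5 : ∏ j, s j ^ (-a j).toNat ≠ 0 := Finset.prod_ne_zero_iff.2 fun j _ => by
      by_cases hj : s j = 0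
      · have := h0 j hj
        rw [show (-a j).toNat = 0 by omega, pow_zero]
        exact one_ne_zero
      · exact pow_ne_zero _ hj
    exact h5 (h3 ▸ h4)
  choose! f hfW hf0 hfpos using key
  have hmem : ∑ i ∈ Finset.univ.filter (· ∈ J), f i ∈ W :=
    Submodule.sum_mem _ fun i hi => hfW i (Finset.mem_filter.1 hi).2
  refine ⟨_, fun k => ?_, fun j hj => ?_, fun j hj => hmem.2 j hj⟩
  · have := congrArg (Rat.cast : ℚ → ℂ) (hmem.1 k)
    push_cast at this
    exact this
  · rw [Finset.sum_apply]
    exact Finset.sum_pos' (fun i hi => hf0 i (Finset.mem_filter.1 hi).2 j)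
      ⟨j, Finset.mem_filter.2 ⟨Finset.mem_univ j, hj⟩, hfpos j hj⟩

/-- The binomial variety is the closure of the subtorus. -/
theorem binomialVariety_subset_closure (B : Matrix (Fin d) (Fin n) ℤ) :
    binomialVariety B ⊆ closure (torusExp '' complexKer B) := by
  intro s hs
  obtain ⟨z, hz, hzs⟩ := exists_mem_complexKer_torusExp_apply_eq hs
  obtain ⟨w, hw, hpos, hzero⟩ := exists_mem_complexKer_pos hs
  refine mem_closure_of_tendsto (b := Filter.atTop)
    (f := fun τ : ℝ => torusExp (z + ((τ : ℂ) * Complex.I) • fun j => (w j : ℂ))) ?_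
    (Filter.Eventually.of_forall fun τ => ⟨_, fun k => ?_, rfl⟩)
  · rw [tendsto_pi_nhds]
    intro j
    by_cases hj : s j = 0
    · rw [hj, tendsto_zero_iff_norm_tendsto_zero]
      have h1 : ∀ τ : ℝ, ‖torusExp (z + ((τ : ℂ) * Complex.I) • fun j => (w j : ℂ)) j‖ =
          ‖torusExp z j‖ * Real.exp (-(2 * Real.pi * (w j : ℝ)) * τ) := by
        intro τ
        rw [torusExp_add, Pi.mul_apply, norm_mul]
        congr 1
        rw [torusExp, Complex.norm_exp]
        congr 1
        simp [Complex.mul_re, Complex.mul_im]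
        ring
      simp only [h1]
      rw [← mul_zero ‖torusExp z j‖]
      refine Filter.Tendsto.const_mul _ (Real.tendsto_exp_atBot.comp ?_)
      refine Filter.Tendsto.const_mul_atTop_of_neg ?_ Filter.tendsto_id
      have : (0 : ℝ) < w j := by exact_mod_cast hpos j hj
      have := Real.pi_pos
      rw [neg_lt_zero]; positivity
    · refine tendsto_const_nhds.congr fun τ => ?_
      rw [torusExp_add, Pi.mul_apply, hzs j hj]
      simp [torusExp, hzero j hj]
  · have h1 := hz k
    have h2 := hw k
    simp only [Pi.add_apply, Pi.smul_apply, smul_eq_mul, add_mul, Finset.sum_add_distrib, h1,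
      mul_assoc, ← Finset.mul_sum, h2, mul_zero, add_zero]

/-- Inside the complex torus the binomial variety is the subtorus. -/
theorem exists_torusExp_eq_of_mem_binomialVariety {B : Matrix (Fin d) (Fin n) ℤ} {s : Fin n → ℂ}
    (hs : s ∈ binomialVariety B) (h0 : ∀ j, s j ≠ 0) : ∃ z ∈ complexKer B, torusExp z = s := by
  obtain ⟨z, hz, h⟩ := exists_mem_complexKer_torusExp_apply_eq hs
  exact ⟨z, hz, funext fun j => h j (h0 j)⟩

/-- By Hilbert's basis theorem finitely many of the binomials suffice. -/
theorem exists_finset_binomialVariety_eq (B : Matrix (Fin d) (Fin n) ℤ) :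
    ∃ F : Finset (Fin n → ℤ), binomialVariety B =
      {s | ∀ a ∈ F, ∏ j, s j ^ (a j).toNat - ∏ j, s j ^ (-a j).toNat = 0} := by
  classical
  set P : (Fin n → ℤ) → MvPolynomial (Fin n) ℂ := fun a =>
    ∏ j, MvPolynomial.X j ^ (a j).toNat - ∏ j, MvPolynomial.X j ^ (-a j).toNat with hP
  have hev : ∀ a s, MvPolynomial.eval s (P a) =
      ∏ j, s j ^ (a j).toNat - ∏ j, s j ^ (-a j).toNat := fun a s => by simp [hP, map_prod]
  have hfg : (Submodule.span (MvPolynomial (Fin n) ℂ) (P '' (relationLattice B : Set _))).FG :=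
    IsNoetherian.noetherian _
  obtain ⟨S, hS, hspan⟩ := (Submodule.fg_span_iff_fg_span_finset_subset _).1 hfg
  obtain ⟨F, hF, rfl⟩ := Finset.subset_set_image_iff.1 hS
  refine ⟨F, Set.ext fun s => ⟨fun hs a ha => sub_eq_zero.2 (hs a (hF ha)), fun hs a ha => ?_⟩⟩
  rw [← sub_eq_zero, ← hev]
  have h1 : P a ∈ Submodule.span (MvPolynomial (Fin n) ℂ) ((F.image P : Finset _) : Set _) := by
    rw [← hspan]; exact Submodule.subset_span ⟨a, ha, rfl⟩
  have h2 : Submodule.span (MvPolynomial (Fin n) ℂ) ((F.image P : Finset _) : Set _) ≤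
      RingHom.ker (MvPolynomial.eval s) := by
    rw [Submodule.span_le]
    intro p hp
    obtain ⟨b, hb, rfl⟩ := Finset.mem_image.1 (Finset.mem_coe.1 hp)
    show MvPolynomial.eval s (P b) = 0
    rw [hev]; exact hs b hb
  exact h2 h1

end Torus

/-! ### Analytic subsets -/

section Analytic

variable {E : Type*} [NormedAddCommGroup E] [NormedSpace ℂ E] {Ω : Set E}

theorem differentiableOn_finsetProd {ι : Type*} {f : ι → E → ℂ} {W : Set E} (s : Finset ι)
    (hf : ∀ i, DifferentiableOn ℂ (f i) W) : DifferentiableOn ℂ (fun x => ∏ i ∈ s, f i x) W :=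
  open Classical in fun x hx => (HasFDerivWithinAt.finsetProd (u := s) fun i _ =>
    (hf i x hx).hasFDerivWithinAt).differentiableWithinAt

theorem isAnalyticSubset_of_finite {X : Set E} (hX : X ⊆ Ω)
    (h : ∀ p ∈ Ω, ∃ W : Set E, IsOpen W ∧ p ∈ W ∧ W ⊆ Ω ∧ ∃ (ι : Type) (_ : Finite ι)
      (g : ι → E → ℂ), (∀ i, DifferentiableOn ℂ (g i) W) ∧
        X ∩ W = {x | x ∈ W ∧ ∀ i, g i x = 0}) : IsAnalyticSubset Ω X := by
  refine ⟨hX, fun p hp => ?_⟩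
  obtain ⟨W, hW, hpW, hWΩ, ι, _, g, hg, hXW⟩ := h p hp
  obtain ⟨k, ⟨e⟩⟩ := Finite.exists_equiv_fin ι
  refine ⟨W, hW, hpW, hWΩ, k, fun i => g (e.symm i), fun i => hg _, ?_⟩
  rw [hXW]
  ext x
  exact and_congr_right fun _ => e.symm.forall_congr_right.symm

theorem IsAnalyticSubset.inter {A B : Set E} (hA : IsAnalyticSubset Ω A)
    (hB : IsAnalyticSubset Ω B) : IsAnalyticSubset Ω (A ∩ B) := by
  refine isAnalyticSubset_of_finite (Set.inter_subset_left.trans hA.1) fun p hp => ?_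
  obtain ⟨V, hV, hpV, hVΩ, k, f, hf, hAV⟩ := hA.2 p hp
  obtain ⟨W, hW, hpW, hWΩ, l, g, hg, hBW⟩ := hB.2 p hp
  refine ⟨V ∩ W, hV.inter hW, ⟨hpV, hpW⟩, Set.inter_subset_left.trans hVΩ, Fin k ⊕ Fin l,
    inferInstance, Sum.elim f g, ?_, ?_⟩
  · rintro (i | i)
    · exact (hf i).mono Set.inter_subset_left
    · exact (hg i).mono Set.inter_subset_right
  · ext x
    have h1 : x ∈ A ∩ V ↔ x ∈ V ∧ ∀ i, f i x = 0 := by rw [hAV]; rfl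
    have h2 : x ∈ B ∩ W ↔ x ∈ W ∧ ∀ i, g i x = 0 := by rw [hBW]; rfl
    simp only [Set.mem_inter_iff, Set.mem_ofPred_eq, Sum.forall, Sum.elim_inl, Sum.elim_inr]
      at h1 h2 ⊢
    tauto

/-- A locally finite union of analytic subsets is analytic: locally it is the common zero set of
all products with one factor from the equations of each member. -/
theorem isAnalyticSubset_sUnion (hΩ : IsOpen Ω) {𝓩 : Set (Set E)}
    (h𝓩 : ∀ Z ∈ 𝓩, IsAnalyticSubset Ω Z)
    (hfin : ∀ p ∈ Ω, ∃ W, IsOpen W ∧ p ∈ W ∧ {Z | Z ∈ 𝓩 ∧ (Z ∩ W).Nonempty}.Finite) :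
    IsAnalyticSubset Ω (⋃₀ 𝓩) := by
  refine isAnalyticSubset_of_finite (Set.sUnion_subset fun Z hZ => (h𝓩 Z hZ).1) fun p hp => ?_
  obtain ⟨V, hV, hpV, hS⟩ := hfin p hp
  set S := {Z | Z ∈ 𝓩 ∧ (Z ∩ V).Nonempty} with hSdef
  have : Finite S := hS
  have : Fintype S := Fintype.ofFinite S
  choose W hW hpW hWΩ k g hg hZW using fun Z : S => (h𝓩 Z Z.2.1).2 p hp
  -- the choices of one equation for each member, numbered to obtain an index type in `Type`
  obtain ⟨m, ⟨e⟩⟩ := Finite.exists_equiv_fin (∀ Z : S, Fin (k Z))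
  refine ⟨V ∩ Ω ∩ ⋂ Z, W Z, (hV.inter hΩ).inter (isOpen_iInter_of_finite hW),
    ⟨⟨hpV, hp⟩, Set.mem_iInter.2 hpW⟩, fun x hx => hx.1.2, Fin m, inferInstance,
    fun c x => ∏ Z, g Z (e.symm c Z) x, fun c => ?_, ?_⟩
  · exact differentiableOn_finsetProd _ fun Z =>
      (hg Z _).mono (Set.inter_subset_right.trans (Set.iInter_subset _ Z))
  · ext x
    simp only [Set.mem_inter_iff, Set.mem_ofPred_eq, and_comm (a := x ∈ ⋃₀ 𝓩)]
    refine and_congr_right fun hx => ?_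
    have hiff : ∀ Z : S, x ∈ (Z : Set E) ↔ ∀ i, g Z i x = 0 := fun Z => by
      have hxW := Set.mem_iInter.1 hx.2 Z
      have : x ∈ (Z : Set E) ∩ W Z ↔ x ∈ W Z ∧ ∀ i, g Z i x = 0 := by rw [hZW]; rfl
      simpa [hxW] using this
    constructor
    · rintro ⟨Z, hZ, hxZ⟩ c
      exact Finset.prod_eq_zero (Finset.mem_univ (⟨Z, hZ, x, hxZ, hx.1.1⟩ : S))
        ((hiff ⟨Z, hZ, x, hxZ, hx.1.1⟩).1 hxZ _)
    · intro h
      by_contra hcon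
      have h1 : ∀ Z : S, ∃ i, g Z i x ≠ 0 := fun Z => by
        by_contra h2
        push Not at h2
        exact hcon ⟨Z, Z.2.1, (hiff Z).2 h2⟩
      choose c hc using h1
      have h2 := h (e c)
      simp only [Equiv.symm_apply_apply] at h2
      exact Finset.prod_ne_zero_iff.2 (fun Z _ => hc Z) h2

theorem IsAnalyticSubset.union (hΩ : IsOpen Ω) {A B : Set E} (hA : IsAnalyticSubset Ω A)
    (hB : IsAnalyticSubset Ω B) : IsAnalyticSubset Ω (A ∪ B) := by
  rw [← Set.sUnion_pair]
  refine isAnalyticSubset_sUnion hΩ ?_ fun p _ => ⟨Set.univ, isOpen_univ, Set.mem_univ p,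
    (Set.toFinite {A, B}).subset fun Z hZ => hZ.1⟩
  rintro Z (rfl | rfl)
  exacts [hA, hB]

/-- An analytic subset of `Ω` is closed in `Ω`. -/
theorem IsAnalyticSubset.closure_inter_subset {X S : Set E} (hX : IsAnalyticSubset Ω X)
    (hS : S ⊆ X) : closure S ∩ Ω ⊆ X := by
  rintro p ⟨hpS, hpΩ⟩
  obtain ⟨W, hW, hpW, hWΩ, k, g, hg, hXW⟩ := hX.2 p hpΩ
  by_contra hpX
  obtain ⟨i, hi⟩ : ∃ i, g i p ≠ 0 := by
    by_contra h
    push Not at h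
    have : p ∈ X ∩ W := by rw [hXW]; exact ⟨hpW, h⟩
    exact hpX this.1
  have h1 : ∀ᶠ x in nhds p, g i x ≠ 0 :=
    ((hg i).continuousOn.continuousAt (hW.mem_nhds hpW)).eventually_ne hi
  obtain ⟨x, ⟨hx1, hx2⟩, hxS⟩ :=
    mem_closure_iff_nhds.1 hpS _ (Filter.inter_mem h1 (hW.mem_nhds hpW))
  have h2 : x ∈ X ∩ W := ⟨hS hxS, hx2⟩
  rw [hXW] at h2
  exact hx1 (h2.2 i)

/-- Identity theorem: if a holomorphic map on a convex open set sends a nonempty open subset into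
an analytic set, it sends everything there. It is enough to consider complex lines. -/
theorem IsAnalyticSubset.mapsTo_of_mapsTo_open {E' : Type*} [NormedAddCommGroup E']
    [NormedSpace ℂ E'] {A : Set E} (hA : IsAnalyticSubset Ω A) {H U : Set E'} (hH : IsOpen H)
    (hHc : Convex ℝ H) {F : E' → E} (hF : DifferentiableOn ℂ F H) (hFΩ : Set.MapsTo F H Ω)
    (hU : IsOpen U) (hUH : U ⊆ H) (hUne : U.Nonempty) (hFU : Set.MapsTo F U A) :
    Set.MapsTo F H A := by
  obtain ⟨u, hu⟩ := hUne
  intro z hz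
  set ℓ : ℂ → E' := fun c => u + c • (z - u) with hℓ
  have hℓd : Differentiable ℂ ℓ := by
    simp only [hℓ]; fun_prop
  set L : Set ℂ := ℓ ⁻¹' H with hL
  have hLo : IsOpen L := hH.preimage hℓd.continuous
  have hLc : Convex ℝ L := by
    intro a ha b hb s t hs ht hst
    have : ℓ (s • a + t • b) = s • ℓ a + t • ℓ b := by
      simp only [hℓ, smul_add, add_smul, smul_assoc]
      have h1 : u = s • u + t • u := by rw [← add_smul, hst, one_smul]
      nth_rewrite 1 [h1]
      abel
    show ℓ _ ∈ H
    rw [this]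
    exact hHc ha hb hs ht hst
  have hφ : DifferentiableOn ℂ (F ∘ ℓ) L := hF.comp hℓd.differentiableOn fun c hc => hc
  have hsub : L ⊆ {c | ∀ᶠ c' in nhds c, F (ℓ c') ∈ A} := by
    refine hLc.isPreconnected.subset_of_closure_inter_subset isOpen_setOfPred_eventually_nhds
      ⟨0, ?_, ?_⟩ ?_
    · show ℓ 0 ∈ H
      simpa [hℓ] using hUH hu
    · have h1 : ∀ᶠ c in nhds (0 : ℂ), ℓ c ∈ U :=
        hℓd.continuous.continuousAt.eventually (hU.mem_nhds (by simpa [hℓ] using hu))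
      exact h1.mono fun c hc => hFU hc
    · rintro c ⟨hcu, hcL⟩
      obtain ⟨W, hW, hpW, hWΩ, k, g, hg, hAW⟩ := hA.2 (F (ℓ c)) (hFΩ hcL)
      have h1 : ∀ᶠ c' in nhds c, c' ∈ L ∧ (F ∘ ℓ) c' ∈ W :=
        (hLo.eventually_mem hcL).and
          ((hφ.continuousOn.continuousAt (hLo.mem_nhds hcL)).eventually (hW.mem_nhds hpW))
      obtain ⟨ε, hε, hball⟩ := Metric.eventually_nhds_iff_ball.1 h1
      obtain ⟨c₁, hc₁b, hc₁⟩ := mem_closure_iff_nhds.1 hcu _ (Metric.ball_mem_nhds c hε)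
      have h2 : ∀ i, ∀ c' ∈ Metric.ball c ε, g i (F (ℓ c')) = 0 := by
        intro i
        have hd : DifferentiableOn ℂ (g i ∘ (F ∘ ℓ)) (Metric.ball c ε) :=
          (hg i).comp (hφ.mono fun x hx => (hball x hx).1) fun x hx => (hball x hx).2
        refine (hd.analyticOnNhd Metric.isOpen_ball).eqOn_zero_of_preconnected_of_eventuallyEq_zero
          (convex_ball c ε).isPreconnected hc₁b ?_
        filter_upwards [hc₁, Metric.isOpen_ball.mem_nhds hc₁b] with c' h3 h4
        have h5 : F (ℓ c') ∈ A ∩ W := ⟨h3, (hball c' h4).2⟩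
        rw [hAW] at h5
        exact h5.2 i
      filter_upwards [Metric.ball_mem_nhds c hε] with c' hc'
      have h5 : F (ℓ c') ∈ A ∩ W := by
        rw [hAW]; exact ⟨(hball c' hc').2, fun i => h2 i c' hc'⟩
      exact h5.1
  have h1 : (1 : ℂ) ∈ L := by
    show ℓ 1 ∈ H
    simpa [hℓ] using hz
  simpa [hℓ] using (hsub h1).self_of_nhds

/-- An analytic set in which a holomorphic image of a convex open set is dense is irreducible. -/
theorem isIrreducibleAnalyticSubset_closure_image {E' : Type*} [NormedAddCommGroup E']
    [NormedSpace ℂ E'] {H : Set E'} (hH : IsOpen H) (hHc : Convex ℝ H) (hne : H.Nonempty)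
    {F : E' → E} (hF : DifferentiableOn ℂ F H) (hFΩ : Set.MapsTo F H Ω)
    (hZ : IsAnalyticSubset Ω (closure (F '' H) ∩ Ω)) :
    IsIrreducibleAnalyticSubset Ω (closure (F '' H) ∩ Ω) := by
  have hmem : ∀ z ∈ H, F z ∈ closure (F '' H) ∩ Ω := fun z hz =>
    ⟨subset_closure ⟨z, hz, rfl⟩, hFΩ hz⟩
  refine ⟨hZ, hne.imp' F hmem, fun A B hA hB hAB => ?_⟩
  have key : ∀ C, IsAnalyticSubset Ω C → C ⊆ closure (F '' H) ∩ Ω → Set.MapsTo F H C →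
      closure (F '' H) ∩ Ω = C := fun C hC hCs hFC =>
    (hC.closure_inter_subset (Set.image_subset_iff.2 hFC)).antisymm hCs
  by_cases h : Set.MapsTo F H A
  · exact Or.inl (key A hA (hAB ▸ Set.subset_union_left) h)
  · right
    refine key B hB (hAB ▸ Set.subset_union_right) ?_
    simp only [Set.MapsTo, not_forall] at h
    obtain ⟨z, hz, hzA⟩ := h
    -- the complement of the preimage of `A` is open
    have hopen : IsOpen (H ∩ F ⁻¹' (closure A)ᶜ) :=
      hF.continuousOn.isOpen_inter_preimage hH isClosed_closure.isOpen_compl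
    refine hB.mapsTo_of_mapsTo_open hH hHc hF hFΩ hopen Set.inter_subset_left
      ⟨z, hz, fun hc => hzA (hA.closure_inter_subset subset_rfl ⟨hc, hFΩ hz⟩)⟩ ?_
    rintro w ⟨hw, hwA⟩
    have := hmem w hw
    rw [hAB] at this
    exact this.resolve_left fun h => hwA (subset_closure h)

theorem IsIrreducibleAnalyticSubset.subset_or_subset {Y A B : Set E}
    (hY : IsIrreducibleAnalyticSubset Ω Y) (hA : IsAnalyticSubset Ω A) (hB : IsAnalyticSubset Ω B)
    (h : Y ⊆ A ∪ B) : Y ⊆ A ∨ Y ⊆ B := by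
  have := hY.2.2 (Y ∩ A) (Y ∩ B) (hY.1.inter hA) (hY.1.inter hB)
    (by rw [← Set.inter_union_distrib_left, Set.inter_eq_left.2 h])
  exact this.imp (fun h => Set.inter_eq_left.1 h.symm) (fun h => Set.inter_eq_left.1 h.symm)

/-- An irreducible analytic set contained in a locally finite union is contained in a member. -/
theorem IsIrreducibleAnalyticSubset.exists_subset_of_subset_sUnion (hΩ : IsOpen Ω) {Y : Set E}
    (hY : IsIrreducibleAnalyticSubset Ω Y) {𝓩 : Set (Set E)}
    (h𝓩 : ∀ Z ∈ 𝓩, IsAnalyticSubset Ω Z)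
    (hfin : ∀ p ∈ Ω, ∃ W, IsOpen W ∧ p ∈ W ∧ {Z | Z ∈ 𝓩 ∧ (Z ∩ W).Nonempty}.Finite)
    (h : Y ⊆ ⋃₀ 𝓩) : ∃ Z ∈ 𝓩, Y ⊆ Z := by
  have hind : ∀ S : Set (Set E), S.Finite → S ⊆ 𝓩 → ∀ R, IsAnalyticSubset Ω R →
      Y ⊆ ⋃₀ S ∪ R → (∃ Z ∈ S, Y ⊆ Z) ∨ Y ⊆ R := by
    intro S hS
    induction S, hS using Set.Finite.induction_on with
    | empty => intro _ R _ hYR; right; simpa using hYR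
    | @insert Z S _ _ ih =>
      intro hSZ R hR hYR
      have hZ := h𝓩 Z (hSZ (Set.mem_insert Z S))
      rw [Set.sUnion_insert, Set.union_comm Z, Set.union_assoc] at hYR
      rcases ih ((Set.subset_insert Z S).trans hSZ) _ (hZ.union hΩ hR) hYR with ⟨Z', hZ', h1⟩ | h1
      · exact Or.inl ⟨Z', Set.mem_insert_of_mem _ hZ', h1⟩
      · exact (hY.subset_or_subset hZ hR h1).imp_left fun h2 => ⟨Z, Set.mem_insert Z S, h2⟩
  obtain ⟨p, hp⟩ := hY.2.1
  obtain ⟨W, hW, hpW, hS⟩ := hfin p (hY.1.1 hp)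
  -- the members that stay away from `p` form an analytic set not containing `p`
  set 𝓡 := {Z | Z ∈ 𝓩 ∧ ¬(Z ∩ W).Nonempty} with h𝓡
  have hR : IsAnalyticSubset Ω (⋃₀ 𝓡) := isAnalyticSubset_sUnion hΩ (fun Z hZ => h𝓩 Z hZ.1)
    fun q hq => by
      obtain ⟨V, hV, hqV, hVfin⟩ := hfin q hq
      exact ⟨V, hV, hqV, hVfin.subset fun Z hZ => ⟨hZ.1.1, hZ.2⟩⟩
  have hcover : Y ⊆ ⋃₀ {Z | Z ∈ 𝓩 ∧ (Z ∩ W).Nonempty} ∪ ⋃₀ 𝓡 := by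
    intro y hy
    obtain ⟨Z, hZ, hyZ⟩ := h hy
    by_cases hZW : (Z ∩ W).Nonempty
    · exact Or.inl ⟨Z, ⟨hZ, hZW⟩, hyZ⟩
    · exact Or.inr ⟨Z, ⟨hZ, hZW⟩, hyZ⟩
  rcases hind _ hS (fun Z hZ => hZ.1) _ hR hcover with ⟨Z, hZ, h1⟩ | h1
  · exact ⟨Z, hZ.1, h1⟩
  · obtain ⟨Z, hZ, hpZ⟩ := h1 hp
    exact absurd ⟨p, hpZ, hpW⟩ hZ.2

theorem irreducibleAnalyticComponents_sUnion (hΩ : IsOpen Ω) {𝓩 : Set (Set E)}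
    (h𝓩 : ∀ Z ∈ 𝓩, IsIrreducibleAnalyticSubset Ω Z)
    (hfin : ∀ p ∈ Ω, ∃ W, IsOpen W ∧ p ∈ W ∧ {Z | Z ∈ 𝓩 ∧ (Z ∩ W).Nonempty}.Finite)
    (hanti : ∀ Z ∈ 𝓩, ∀ Z' ∈ 𝓩, Z ⊆ Z' → Z = Z') :
    irreducibleAnalyticComponents Ω (⋃₀ 𝓩) = 𝓩 := by
  have key : ∀ Y, IsIrreducibleAnalyticSubset Ω Y → Y ⊆ ⋃₀ 𝓩 → ∃ Z ∈ 𝓩, Y ⊆ Z := fun Y hY h =>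
    hY.exists_subset_of_subset_sUnion hΩ (fun Z hZ => (h𝓩 Z hZ).1) hfin h
  ext Z
  constructor
  · rintro ⟨⟨h1, h2⟩, h3⟩
    obtain ⟨Z', hZ', hZZ'⟩ := key Z h1 h2
    rwa [hZZ'.antisymm (h3 ⟨h𝓩 Z' hZ', Set.subset_sUnion_of_mem hZ'⟩ hZZ')]
  · intro hZ
    refine ⟨⟨h𝓩 Z hZ, Set.subset_sUnion_of_mem hZ⟩, ?_⟩
    rintro Y ⟨hY, hYX⟩ hZY
    obtain ⟨Z', hZ', hYZ'⟩ := key Y hY hYX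
    rw [hanti Z hZ Z' hZ' (hZY.trans hYZ')]
    exact hYZ'

end Analytic

/-! ### Closures of the sheets -/

section Sheet

variable {n d : ℕ} {T : Fin n → Matrix (Fin d) (Fin d) ℤ}

theorem isOpen_polydisk_prod_univ :
    IsOpen (polydisk n ×ˢ (Set.univ : Set (Fin d → ℂ))) := by
  have : polydisk n = ⋂ j, {t | ‖t j‖ < 1} := by ext; simp [polydisk]
  rw [this]
  exact (isOpen_iInter_of_finite fun j =>
    isOpen_lt (continuous_apply j).norm continuous_const).prod isOpen_univ

theorem torusExp_mem_polydisk_iff {z : Fin n → ℂ} :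
    torusExp z ∈ polydisk n ↔ ∀ j, 0 < (z j).im := by
  refine forall_congr' fun j => ?_
  rw [torusExp, Complex.norm_exp, Real.exp_lt_one_iff]
  have : (2 * Real.pi * Complex.I * z j).re = -(2 * Real.pi * (z j).im) := by
    simp [Complex.mul_re, Complex.mul_im]
  rw [this, neg_lt_zero, mul_pos_iff_of_pos_left Real.two_pi_pos]

theorem sheet_eq_image (h : Fin d → ℤ) :
    sheet T h = (fun z => (torusExp z, unip (fun j => negLog (T j)) z *ᵥ intVec h)) ''
      {z | ∀ j, 0 < (z j).im} := by
  ext p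
  exact exists_congr fun z => and_congr_right fun _ => eq_comm

theorem commute_negLog_of_commute (hT : ∀ i j, Commute (T i) (T j)) (i j : Fin n) :
    Commute (negLog (T i)) (negLog (T j)) := commute_negLog (hT i j)

/-- The integral matrix with columns `d! N_j h`, where `N_j = -log T_j`. Its complex kernel is the
Lie algebra of the stabilizer of `h`. -/
def stabilizerMatrix (T : Fin n → Matrix (Fin d) (Fin d) ℤ) (h : Fin d → ℤ) :
    Matrix (Fin d) (Fin n) ℤ :=
  Matrix.of fun k j => ((exists_factorial_smul_negLog (T j)).choose *ᵥ h) k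

theorem mem_complexKer_stabilizerMatrix {h : Fin d → ℤ} {z : Fin n → ℂ} :
    z ∈ complexKer (stabilizerMatrix T h) ↔
      pencilAt (fun j => negLog (T j)) (intVec h) z = 0 := by
  have key := smul_pencilAt_intVec (N := fun j => negLog (T j))
    (fun j => (exists_factorial_smul_negLog (T j)).choose_spec) h z
  have hd : (d.factorial : ℂ) ≠ 0 := by exact_mod_cast d.factorial_ne_zero
  rw [← smul_eq_zero_iff_right hd, key]
  exact funext_iff.symm

/-- The set of equations that cuts out the closure of the sheet of `h`, in terms of a section `σ`
of the orbit map: `v` lies on the orbit of `h`, and after the automorphism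
`(t, v) ↦ (t e^{-2πi σ(v)}, v)` the first component lies on a toric variety. -/
def sheetEquations (T : Fin n → Matrix (Fin d) (Fin d) ℤ) (h : Fin d → ℤ)
    (σ : (Fin d → ℂ) → (Fin n → ℂ)) : Set ((Fin n → ℂ) × (Fin d → ℂ)) :=
  {p | unip (fun j => negLog (T j)) (-σ p.2) *ᵥ p.2 = intVec h ∧
    p.1 * torusExp (-σ p.2) ∈ binomialVariety (stabilizerMatrix T h)}

/-- The section `σ` recovers the parameter of a point on the orbit up to the stabilizer. -/
def IsOrbitSection (T : Fin n → Matrix (Fin d) (Fin d) ℤ) (h : Fin d → ℤ)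
    (σ : (Fin d → ℂ) → (Fin n → ℂ)) : Prop :=
  Differentiable ℂ σ ∧ ∀ z, pencilAt (fun j => negLog (T j)) (intVec h)
    (σ (unip (fun j => negLog (T j)) z *ᵥ intVec h)) =
      pencilAt (fun j => negLog (T j)) (intVec h) z

theorem exists_isOrbitSection (hT : ∀ i j, Commute (T i) (T j))
    (hunip : ∀ j, IsNilpotent (T j - 1)) (h : Fin d → ℤ) : ∃ σ, IsOrbitSection T h σ :=
  exists_orbit_section (commute_negLog_of_commute hT) (fun j => isNilpotent_negLog (hunip j)) _

theorem IsOrbitSection.unip_neg_mulVec (hT : ∀ i j, Commute (T i) (T j)) {h : Fin d → ℤ}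
    {σ : (Fin d → ℂ) → (Fin n → ℂ)} (hσ : IsOrbitSection T h σ) (z : Fin n → ℂ)
    {v : Fin d → ℂ} (hv : v = unip (fun j => negLog (T j)) z *ᵥ intVec h) :
    unip (fun j => negLog (T j)) (-σ v) *ᵥ v = intVec h := by
  have hN := commute_negLog_of_commute hT
  conv_lhs => rw [hv]
  rw [Matrix.mulVec_mulVec, ← unip_add hN]
  refine unip_mulVec_eq_self hN ?_
  rw [map_add, map_neg, hσ.2, neg_add_cancel]

theorem IsOrbitSection.sub_mem_complexKer {h : Fin d → ℤ}
    {σ : (Fin d → ℂ) → (Fin n → ℂ)} (hσ : IsOrbitSection T h σ) (z : Fin n → ℂ) :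
    z - σ (unip (fun j => negLog (T j)) z *ᵥ intVec h) ∈
      complexKer (stabilizerMatrix T h) := by
  rw [mem_complexKer_stabilizerMatrix, map_sub, hσ.2, sub_self]

theorem isClosed_sheetEquations {h : Fin d → ℤ} {σ : (Fin d → ℂ) → (Fin n → ℂ)}
    (hσ : Differentiable ℂ σ) : IsClosed (sheetEquations T h σ) := by
  have h1 : Continuous fun p : (Fin n → ℂ) × (Fin d → ℂ) =>
      unip (fun j => negLog (T j)) (-σ p.2) *ᵥ p.2 :=
    (differentiable_unip_mulVec _ (hσ.comp differentiable_snd).neg differentiable_snd).continuous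
  have h2 : Continuous fun p : (Fin n → ℂ) × (Fin d → ℂ) => p.1 * torusExp (-σ p.2) :=
    continuous_fst.mul
      ((differentiable_torusExp.comp (hσ.comp differentiable_snd).neg).continuous)
  exact (isClosed_eq h1 continuous_const).inter ((isClosed_binomialVariety _).preimage h2)

theorem sheet_subset_sheetEquations (hT : ∀ i j, Commute (T i) (T j)) {h : Fin d → ℤ}
    {σ : (Fin d → ℂ) → (Fin n → ℂ)} (hσ : IsOrbitSection T h σ) :
    sheet T h ⊆ sheetEquations T h σ := by
  rw [sheet_eq_image]
  rintro _ ⟨z, _, rfl⟩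
  refine ⟨hσ.unip_neg_mulVec hT z rfl, ?_⟩
  show torusExp z * _ ∈ _
  rw [← torusExp_add, ← sub_eq_add_neg]
  exact torusExp_mem_binomialVariety (hσ.sub_mem_complexKer z)

/-- The closure of a sheet is given by its equations. They are closed conditions; conversely a point
`(t, v)` satisfying them has `t e^{-2πi σ(v)}` in the closure of the subtorus, and moving this
component inside the subtorus, with `v` fixed, approaches `(t, v)` through the sheet. -/
theorem closureInExtension_sheet (hT : ∀ i j, Commute (T i) (T j)) {h : Fin d → ℤ}
    {σ : (Fin d → ℂ) → (Fin n → ℂ)} (hσ : IsOrbitSection T h σ) :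
    closureInExtension (sheet T h) = sheetEquations T h σ ∩ polydisk n ×ˢ Set.univ := by
  have hN := commute_negLog_of_commute hT
  refine Set.Subset.antisymm (Set.inter_subset_inter_left _
    (closure_minimal (sheet_subset_sheetEquations hT hσ) (isClosed_sheetEquations hσ.1))) ?_
  rintro ⟨t, v⟩ ⟨⟨h1, h2⟩, hΩ⟩
  simp only at h1 h2
  refine ⟨?_, hΩ⟩
  set Ψ : (Fin n → ℂ) → (Fin n → ℂ) × (Fin d → ℂ) := fun s => (s * torusExp (σ v), v) with hΨ
  have hΨc : Continuous Ψ := (continuous_id.mul continuous_const).prodMk continuous_const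
  have h3 : (t, v) = Ψ (t * torusExp (-σ v)) := by
    have : torusExp (-σ v) * torusExp (σ v) = 1 := by
      rw [← torusExp_add, neg_add_cancel]; funext j; simp [torusExp]
    simp only [hΨ, mul_assoc, this, mul_one]
  have h4 : (t, v) ∈ closure (Ψ '' (torusExp '' complexKer (stabilizerMatrix T h))) := by
    rw [h3]
    exact image_closure_subset_closure_image hΨc ⟨_, binomialVariety_subset_closure _ h2, rfl⟩
  refine closure_mono ?_ (isOpen_polydisk_prod_univ.inter_closure ⟨hΩ, h4⟩)
  rintro _ ⟨hw, _, ⟨z, hz, rfl⟩, rfl⟩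
  rw [sheet_eq_image]
  have h5 : torusExp z * torusExp (σ v) = torusExp (σ v + z) := by
    rw [torusExp_add, mul_comm]
  refine ⟨σ v + z, torusExp_mem_polydisk_iff.1 (h5 ▸ hw.1), ?_⟩
  simp only [hΨ, h5, Prod.mk.injEq, true_and]
  rw [unip_add hN, ← Matrix.mulVec_mulVec,
    unip_mulVec_eq_self hN (mem_complexKer_stabilizerMatrix.1 hz), ← h1, Matrix.mulVec_mulVec,
    ← unip_add hN, add_neg_cancel, unip_zero, Matrix.one_mulVec]

theorem isAnalyticSubset_closureInExtension_sheet (hT : ∀ i j, Commute (T i) (T j))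
    (hunip : ∀ j, IsNilpotent (T j - 1)) (h : Fin d → ℤ) :
    IsAnalyticSubset (polydisk n ×ˢ Set.univ) (closureInExtension (sheet T h)) := by
  obtain ⟨σ, hσ⟩ := exists_isOrbitSection hT hunip h
  obtain ⟨F, hF⟩ := exists_finset_binomialVariety_eq (stabilizerMatrix T h)
  rw [closureInExtension_sheet hT hσ]
  refine isAnalyticSubset_of_finite Set.inter_subset_right fun p hp =>
    ⟨_, isOpen_polydisk_prod_univ, hp, subset_rfl, Fin d ⊕ F, inferInstance,
      Sum.elim (fun k q => (unip (fun j => negLog (T j)) (-σ q.2) *ᵥ q.2) k - intVec h k)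
        (fun a q => ∏ j, (q.1 * torusExp (-σ q.2)) j ^ (a.1 j).toNat -
          ∏ j, (q.1 * torusExp (-σ q.2)) j ^ (-a.1 j).toNat), ?_, ?_⟩
  · rintro (k | a)
    · have h1 := differentiable_unip_mulVec (fun j => negLog (T j))
        (hσ.1.comp (differentiable_snd (𝕜 := ℂ) (E := Fin n → ℂ))).neg differentiable_snd
      exact (((differentiable_pi.1 h1) k).sub_const _).differentiableOn
    · have h1 : Differentiable ℂ fun q : (Fin n → ℂ) × (Fin d → ℂ) => torusExp (-σ q.2) :=
        differentiable_torusExp.comp (hσ.1.comp differentiable_snd).neg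
      have h2 : ∀ j, Differentiable ℂ fun q : (Fin n → ℂ) × (Fin d → ℂ) =>
          (q.1 * torusExp (-σ q.2)) j := fun j =>
        ((differentiable_pi.1 differentiable_fst) j).mul ((differentiable_pi.1 h1) j)
      exact (differentiableOn_finsetProd _ fun j => ((h2 j).pow _).differentiableOn).sub
        (differentiableOn_finsetProd _ fun j => ((h2 j).pow _).differentiableOn)
  · ext q
    simp only [sheetEquations, hF, Set.mem_inter_iff, Set.mem_ofPred_eq, Sum.forall,
      Sum.elim_inl, Sum.elim_inr, Subtype.forall, sub_eq_zero, funext_iff]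
    tauto

theorem isIrreducibleAnalyticSubset_closureInExtension_sheet (hT : ∀ i j, Commute (T i) (T j))
    (hunip : ∀ j, IsNilpotent (T j - 1)) (h : Fin d → ℤ) :
    IsIrreducibleAnalyticSubset (polydisk n ×ˢ Set.univ) (closureInExtension (sheet T h)) := by
  have hZ := isAnalyticSubset_closureInExtension_sheet hT hunip h
  unfold closureInExtension at hZ ⊢
  rw [sheet_eq_image] at hZ ⊢
  refine isIrreducibleAnalyticSubset_closure_image ?_ ?_ ⟨fun _ => Complex.I, fun _ => by simp⟩
    ?_ (fun z hz => ⟨torusExp_mem_polydisk_iff.2 hz, trivial⟩) hZ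
  · have : {z : Fin n → ℂ | ∀ j, 0 < (z j).im} = ⋂ j, {z | 0 < (z j).im} := by ext; simp
    rw [this]
    exact isOpen_iInter_of_finite fun j =>
      isOpen_lt continuous_const (Complex.continuous_im.comp (continuous_apply j))
  · intro z hz w hw a b ha hb hab j
    have h1 := hz j
    have h2 := hw j
    simp only [Pi.add_apply, Pi.smul_apply, Complex.add_im, Complex.smul_im, smul_eq_mul]
    rcases ha.eq_or_lt with rfl | ha
    · rw [zero_add] at hab
      subst hab
      simpa using h2
    · have := mul_pos ha h1
      have := mul_nonneg hb h2.le
      linarith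
  · exact (differentiable_torusExp.prodMk
      (differentiable_unip_mulVec _ differentiable_id (differentiable_const _))).differentiableOn

/-- Vectors in the same monodromy orbit have the same sheet. -/
theorem sheet_eq_of_unip_intCast (hT : ∀ i j, Commute (T i) (T j)) {h h' : Fin d → ℤ}
    (m : Fin n → ℤ)
    (hm : intVec h = unip (fun j => negLog (T j)) (fun j => (m j : ℂ)) *ᵥ intVec h') :
    sheet T h = sheet T h' := by
  have hN := commute_negLog_of_commute hT
  have key : ∀ (h h' : Fin d → ℤ) (m : Fin n → ℤ),
      intVec h = unip (fun j => negLog (T j)) (fun j => (m j : ℂ)) *ᵥ intVec h' →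
      sheet T h ⊆ sheet T h' := by
    intro h h' m hm
    rw [sheet_eq_image, sheet_eq_image]
    rintro _ ⟨z, hz, rfl⟩
    refine ⟨z + fun j => (m j : ℂ), fun j => by simpa using hz j, ?_⟩
    simp only [hm, Matrix.mulVec_mulVec, ← unip_add hN]
    rw [torusExp_add, torusExp_intCast, mul_one]
  refine (key h h' m hm).antisymm (key h' h (fun j => -m j) ?_)
  rw [hm]
  have : (fun j => ((-m j : ℤ) : ℂ)) = -fun j => (m j : ℂ) := by funext j; simp
  rw [this, unip_neg_mulVec_unip_mulVec hN]

/-- There are no proper inclusions between closures of sheets: at a point of the sheet of `h` no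
coordinate of `t` vanishes, so if that point satisfies the equations for `h'` it lies on the sheet
of `h'`, and the two parameters differ by an integral vector. -/
theorem closureInExtension_sheet_eq_of_subset (hT : ∀ i j, Commute (T i) (T j))
    (hunip : ∀ j, IsNilpotent (T j - 1)) {h h' : Fin d → ℤ}
    (hsub : closureInExtension (sheet T h) ⊆ closureInExtension (sheet T h')) :
    closureInExtension (sheet T h) = closureInExtension (sheet T h') := by
  have hN := commute_negLog_of_commute hT
  obtain ⟨σ, hσ⟩ := exists_isOrbitSection hT hunip h'
  set z : Fin n → ℂ := fun _ => Complex.I with hz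
  have hzim : ∀ j, 0 < (z j).im := fun _ => by simp [hz]
  set v := unip (fun j => negLog (T j)) z *ᵥ intVec h with hv
  have h1 : (torusExp z, v) ∈ closureInExtension (sheet T h) := by
    refine ⟨subset_closure ?_, torusExp_mem_polydisk_iff.2 hzim, trivial⟩
    rw [sheet_eq_image]; exact ⟨z, hzim, rfl⟩
  have h2 := hsub h1
  rw [closureInExtension_sheet hT hσ] at h2
  obtain ⟨⟨h3, h4⟩, -⟩ := h2
  simp only [← torusExp_add] at h3 h4
  obtain ⟨w, hw, hwt⟩ := exists_torusExp_eq_of_mem_binomialVariety h4 (torusExp_ne_zero _)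
  obtain ⟨m, hm⟩ := torusExp_eq_iff.1 hwt.symm
  rw [sheet_eq_of_unip_intCast hT (h := h) (h' := h') m]
  have h5 : (fun j => (m j : ℂ)) = -z + σ v + w := by rw [hm]; abel
  rw [h5, unip_add hN, ← Matrix.mulVec_mulVec,
    unip_mulVec_eq_self hN (mem_complexKer_stabilizerMatrix.1 hw), ← h3, Matrix.mulVec_mulVec,
    ← unip_add hN, add_assoc, add_neg_cancel, add_zero, hv, unip_neg_mulVec_unip_mulVec hN]

/-- Only finitely many sheets meet the region over a ball in `ℂ^d`. -/
theorem finite_setOf_closureInExtension_sheet_inter_nonempty (hT : ∀ i j, Commute (T i) (T j))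
    (hunip : ∀ j, IsNilpotent (T j - 1)) (R : ℝ) :
    {Z | Z ∈ Set.range (fun h : Fin d → ℤ => closureInExtension (sheet T h)) ∧
      (Z ∩ {q | ‖q.2‖ < R}).Nonempty}.Finite := by
  have hN := commute_negLog_of_commute hT
  have hfin := finite_setOf_norm_unip_mulVec_le hN (fun j => isNilpotent_negLog (hunip j))
    d.factorial_ne_zero (fun j => (exists_factorial_smul_negLog (T j)).choose_spec) R
  refine (hfin.image fun h => closureInExtension (sheet T h)).subset ?_
  rintro _ ⟨⟨h, rfl⟩, q, ⟨hq, -⟩, hqR⟩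
  have hopen : IsOpen {q : (Fin n → ℂ) × (Fin d → ℂ) | ‖q.2‖ < R} :=
    isOpen_lt continuous_snd.norm continuous_const
  obtain ⟨p, hpR, hp⟩ := mem_closure_iff.1 hq _ hopen hqR
  rw [sheet_eq_image] at hp
  obtain ⟨z, hz, rfl⟩ := hp
  -- translate the real part of `z` into `[0, 1)`
  set m : Fin n → ℤ := fun j => ⌊(z j).re⌋ with hm
  obtain ⟨h', hh'⟩ := exists_unip_intCast_mulVec_intVec hN
    (fun j => by simpa using (hunip j).isUnit_one_add) (fun j => exp_neg_negLog (hunip j)) m h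
  refine ⟨h', ⟨z - fun j => (m j : ℂ), fun j => ?_, ?_⟩, ?_⟩
  · have h1 := Int.floor_le (z j).re
    have h2 := Int.lt_floor_add_one (z j).re
    simp only [hm, Pi.sub_apply, Complex.sub_re, Complex.intCast_re]
    rw [abs_le]
    constructor <;> linarith
  · rw [← hh', Matrix.mulVec_mulVec, ← unip_add hN, sub_add_cancel]
    exact le_of_lt hpR
  · simp only
    rw [sheet_eq_of_unip_intCast hT m hh'.symm]

end Sheet

/-! ### The total space of the local system -/

section TotalSpace

variable {n r d : ℕ}

theorem PullbackTrivialization.point_injective {𝓗 : LocalSystem (divisorComplement n r) d}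
    (τ : PullbackTrivialization 𝓗) (z : universalCover n r) : Function.Injective (τ.point z) := by
  intro h h' e
  have := (Bundle.TotalSpace.mk_inj (F := Fin d → ℤ)).1 e
  exact (τ.coord z).symm.injective this

/-- The monodromy matrices commute, since the translations of the universal covering space do. -/
theorem IsMonodromy.commute {𝓗 : LocalSystem (divisorComplement n r) d}
    {τ : PullbackTrivialization 𝓗} {T : Fin n → Matrix (Fin d) (Fin d) ℤ} (hT : IsMonodromy τ T)
    (i j : Fin n) : Commute (T i) (T j) := by
  by_cases hi : (i : ℕ) < r
  swap
  · rw [hT.2 i (not_lt.1 hi)]; exact Commute.one_left _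
  by_cases hj : (j : ℕ) < r
  swap
  · rw [hT.2 j (not_lt.1 hj)]; exact Commute.one_right _
  set z : universalCover n r :=
    ⟨fun j => if (j : ℕ) < r then Complex.I else 0, fun j => by
      by_cases h : (j : ℕ) < r <;> simp [h]⟩
  have hshift : deckShift i hi (deckShift j hj z) = deckShift j hj (deckShift i hi z) :=
    Subtype.ext (add_right_comm _ _ _)
  refine Matrix.toLin'.injective (LinearMap.ext fun h => τ.point_injective z ?_)
  rw [Matrix.toLin'_apply, Matrix.toLin'_apply, ← Matrix.mulVec_mulVec, ← Matrix.mulVec_mulVec,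
    ← hT.1 i hi, ← hT.1 j hj, ← hT.1 j hj, ← hT.1 i hi, hshift]

theorem unip_eq_of_forall_lt {T : Fin n → Matrix (Fin d) (Fin d) ℤ}
    (hT : ∀ j : Fin n, r ≤ (j : ℕ) → T j = 1) {z w : Fin n → ℂ}
    (h : ∀ j : Fin n, (j : ℕ) < r → z j = w j) :
    unip (fun j => negLog (T j)) z = unip (fun j => negLog (T j)) w := by
  unfold unip
  congr 2
  refine Finset.sum_congr rfl fun j _ => ?_
  by_cases hj : (j : ℕ) < r
  · rw [h j hj]
  · simp only [hT j (not_lt.1 hj), negLog_one, smul_zero]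

/-- The total space consists of the points `(t(z), e^{-zN} h)` with `z` in the universal covering
space and `h ∈ ℤ^d`. -/
theorem mem_totalSpaceInExtension_iff {𝓗 : LocalSystem (divisorComplement n r) d}
    {τ : PullbackTrivialization 𝓗} {T : Fin n → Matrix (Fin d) (Fin d) ℤ}
    (hT : ∀ i j, Commute (T i) (T j)) {p : (Fin n → ℂ) × (Fin d → ℂ)} :
    p ∈ totalSpaceInExtension τ T ↔ ∃ z ∈ universalCover n r, ∃ h : Fin d → ℤ,
      p = (coverFun n r z, unip (fun j => negLog (T j)) z *ᵥ intVec h) := by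
  have hN := commute_negLog_of_commute hT
  have hframe : ∀ (z : Fin n → ℂ) (v : Fin d → ℂ),
      ∑ i, v i • frameSection (fun j => negLog (T j)) z i =
        unip (fun j => negLog (T j)) (-z) *ᵥ v := by
    intro z v
    have h1 : unip (fun j => negLog (T j)) (-z) =
        NormedSpace.exp (∑ j, z j • negLog (T j)) := by
      simp [unip]
    simp only [frameSection, ← h1, ← Matrix.mulVec_smul, ← Matrix.mulVec_sum]
    congr 1
    funext k
    simp [Finset.sum_apply, Pi.single_apply]
  constructor
  · rintro ⟨z, x, h1, h2⟩
    refine ⟨z, z.2, τ.coord z x, Prod.ext h1 ?_⟩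
    rw [hframe] at h2
    have h3 := unip_neg_mulVec_unip_mulVec hN (-(z : Fin n → ℂ)) p.2
    rw [neg_neg, h2] at h3
    exact h3.symm
  · rintro ⟨z, hz, h, rfl⟩
    refine ⟨⟨z, hz⟩, (τ.coord ⟨z, hz⟩).symm h, rfl, ?_⟩
    rw [hframe, unip_neg_mulVec_unip_mulVec hN, AddEquiv.apply_symm_apply]
    rfl

theorem sheet_subset_totalSpaceInExtension {𝓗 : LocalSystem (divisorComplement n r) d}
    {τ : PullbackTrivialization 𝓗} {T : Fin n → Matrix (Fin d) (Fin d) ℤ}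
    (hT : IsMonodromy τ T) (h : Fin d → ℤ) : sheet T h ⊆ totalSpaceInExtension τ T := by
  rw [sheet_eq_image]
  rintro _ ⟨z, hz, rfl⟩
  rw [mem_totalSpaceInExtension_iff hT.commute]
  -- the last `n - r` coordinates of the universal covering space are the `t_j` themselves
  refine ⟨fun j => if (j : ℕ) < r then z j else torusExp z j, fun j => ?_, h, Prod.ext ?_ ?_⟩
  · by_cases hj : (j : ℕ) < r
    · simpa [hj] using hz j
    · simpa [hj] using torusExp_mem_polydisk_iff.2 hz j
  · funext j
    by_cases hj : (j : ℕ) < r <;> simp [coverFun, hj, torusExp]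
  · simp only
    rw [unip_eq_of_forall_lt hT.2 (z := z)]
    intro j hj
    simp [hj]

/-- Over a point where some of the coordinates `t_j` with `j > r` vanish, the total space still
satisfies the equations of the sheets, because the relations do not involve those `t_j`. -/
theorem totalSpaceInExtension_subset {𝓗 : LocalSystem (divisorComplement n r) d}
    {τ : PullbackTrivialization 𝓗} {T : Fin n → Matrix (Fin d) (Fin d) ℤ}
    (hT : IsMonodromy τ T) (hunip : ∀ j, IsNilpotent (T j - 1)) :
    totalSpaceInExtension τ T ⊆ ⋃ h : Fin d → ℤ, closureInExtension (sheet T h) := by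
  intro p hp
  obtain ⟨z, hz, h, rfl⟩ := (mem_totalSpaceInExtension_iff hT.commute).1 hp
  refine Set.mem_iUnion.2 ⟨h, ?_⟩
  obtain ⟨σ, hσ⟩ := exists_isOrbitSection hT.commute hunip h
  rw [closureInExtension_sheet hT.commute hσ]
  refine ⟨⟨hσ.unip_neg_mulVec hT.commute z rfl, ?_⟩, (coverFun_mem hz).1, trivial⟩
  show coverFun n r z * torusExp (-σ _) ∈ _
  set w : Fin n → ℂ := fun j => if (j : ℕ) < r then z j else 0 with hw
  set q : Fin n → ℂ := fun j => if (j : ℕ) < r then 1 else z j with hq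
  have h1 : coverFun n r z = q * torusExp w := by
    funext j
    by_cases hj : (j : ℕ) < r <;> simp [coverFun, torusExp, hw, hq, hj]
  have h2 : unip (fun j => negLog (T j)) z = unip (fun j => negLog (T j)) w :=
    unip_eq_of_forall_lt hT.2 fun j hj => by simp [hw, hj]
  rw [h1, mul_assoc, ← torusExp_add, ← sub_eq_add_neg]
  refine mul_mem_binomialVariety ?_ (torusExp_mem_binomialVariety ?_)
  · intro a ha
    have h3 : ∀ j : Fin n, ¬(j : ℕ) < r → a j = 0 := by
      intro j hj
      have h4 := ha (Pi.single j 1) (mem_complexKer_stabilizerMatrix.2 (by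
        rw [pencilAt_apply]
        refine Finset.sum_eq_zero fun i _ => ?_
        by_cases hij : i = j
        · subst hij
          rw [hT.2 i (not_lt.1 hj), negLog_one, Matrix.zero_mulVec, smul_zero]
        · rw [Pi.single_eq_of_ne hij, zero_smul]))
      simpa [Pi.single_apply] using h4
    have h5 : ∀ j, q j ^ (a j).toNat = 1 ∧ q j ^ (-a j).toNat = 1 := by
      intro j
      by_cases hj : (j : ℕ) < r
      · simp [hq, hj]
      · simp [h3 j hj]
    rw [Finset.prod_congr rfl fun j _ => (h5 j).1, Finset.prod_congr rfl fun j _ => (h5 j).2]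
  · rw [h2]
    exact hσ.sub_mem_complexKer w

end TotalSpace

end

theorem mainTheorem4 {n r d : ℕ} (hr : r ≤ n)
    (𝓗 : LocalSystem (divisorComplement n r) d) (τ : PullbackTrivialization 𝓗)
    (T : Fin n → Matrix (Fin d) (Fin d) ℤ) (hT : IsMonodromy τ T)
    (hunip : ∀ j, IsNilpotent (T j - 1)) :
    IsAnalyticSubset (polydisk n ×ˢ Set.univ)
        (closureInExtension (totalSpaceInExtension τ T)) ∧
      (irreducibleAnalyticComponents (polydisk n ×ˢ Set.univ)
        (closureInExtension (totalSpaceInExtension τ T))).Countable ∧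
      irreducibleAnalyticComponents (polydisk n ×ˢ Set.univ)
          (closureInExtension (totalSpaceInExtension τ T)) =
        Set.range (fun h : Fin d → ℤ => closureInExtension (sheet T h)) ∧
      closureInExtension (totalSpaceInExtension τ T) =
        ⋃ h : Fin d → ℤ, closureInExtension (sheet T h) ∧
      ∀ p ∈ polydisk n ×ˢ (Set.univ : Set (Fin d → ℂ)),
        {Z | (∃ h : Fin d → ℤ, Z = closureInExtension (sheet T h)) ∧ p ∈ Z}.Finite := by
  set 𝓩 := Set.range (fun h : Fin d → ℤ => closureInExtension (sheet T h)) with h𝓩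
  have hΩ := isOpen_polydisk_prod_univ (n := n) (d := d)
  have hirr : ∀ Z ∈ 𝓩, IsIrreducibleAnalyticSubset (polydisk n ×ˢ Set.univ) Z := by
    rintro _ ⟨h, rfl⟩
    exact isIrreducibleAnalyticSubset_closureInExtension_sheet hT.commute hunip h
  have hfin : ∀ p ∈ polydisk n ×ˢ (Set.univ : Set (Fin d → ℂ)),
      ∃ W, IsOpen W ∧ p ∈ W ∧ {Z | Z ∈ 𝓩 ∧ (Z ∩ W).Nonempty}.Finite := fun p _ =>
    ⟨{q | ‖q.2‖ < ‖p.2‖ + 1}, isOpen_lt continuous_snd.norm continuous_const, lt_add_one ‖p.2‖,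
      finite_setOf_closureInExtension_sheet_inter_nonempty hT.commute hunip _⟩
  have han : IsAnalyticSubset (polydisk n ×ˢ Set.univ) (⋃₀ 𝓩) :=
    isAnalyticSubset_sUnion hΩ (fun Z hZ => (hirr Z hZ).1) hfin
  have hunion : closureInExtension (totalSpaceInExtension τ T) = ⋃₀ 𝓩 := by
    refine Set.Subset.antisymm (han.closure_inter_subset ?_) (Set.sUnion_subset ?_)
    · rw [Set.sUnion_range]
      exact totalSpaceInExtension_subset hT hunip
    · rintro _ ⟨h, rfl⟩
      exact Set.inter_subset_inter_left _ (closure_mono (sheet_subset_totalSpaceInExtension hT h))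
  have hcomp : irreducibleAnalyticComponents (polydisk n ×ˢ Set.univ) (⋃₀ 𝓩) = 𝓩 := by
    refine irreducibleAnalyticComponents_sUnion hΩ hirr hfin ?_
    rintro _ ⟨h, rfl⟩ _ ⟨h', rfl⟩ hsub
    exact closureInExtension_sheet_eq_of_subset hT.commute hunip hsub
  rw [hunion]
  refine ⟨han, ?_, hcomp, Set.sUnion_range _, fun p hp => ?_⟩
  · rw [hcomp]; exact Set.countable_range _
  · obtain ⟨W, _, hpW, hWfin⟩ := hfin p hp
    refine hWfin.subset ?_
    rintro _ ⟨⟨h, rfl⟩, hpZ⟩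
    exact ⟨⟨h, rfl⟩, p, hpZ, hpW⟩
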